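/- **Setting.** There are $K$ sensors. Sensor $k$ observes $y^k_1,y^k_2,\dots$. Under hypothesis $\mathsf H_i$ ($i=0,1$; probability $\mathsf P_i$, expectation $\mathsf E_i$) all observations are independent over time and over sensors, and $y^k_t$ has density $f^k_i$ with respect to a reference measure $\nu^k$. The densities $f_0^k$ and $f_1^k$ vanish at the same points (up to $\nu^k$-null sets), and $f_0^k\neq f_1^k$ on a set of positive $\nu^k$-measure for at least one $k$. Put $$L^k_t=\sum_{s=1}^t\log\frac{f^k_1(y^k_s)}{f^k_0(y^k_s)},\qquad L_t=\sum_{k=1}^K L^k_t .$$ **Centralized SPRT.** For $A,B>0$, $\mathcal T=\min\{t\in\mathbb N: L_t\notin(-B,A)\}$; at time $\mathcal T$ it declares $\mathsf H_1$ if $L_{\mathcal T}\ge A$ and $\mathsf H_0$ if $L_{\mathcal T}\le -B$. **Decentralized detector.** Fix $\Delta>0$, $r>0$ and channel delays $d_k\ge 0$. With $t^k_0=0$, sensor $k$ samples at the times $$t^k_n=\min\{t>t^k_{n-1}: |L^k_t-L^k_{t^k_{n-1}}|\ge\Delta\}\quad(n\ge1),$$ with $t^k_n=\infty$ if there is no such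 $t$. For each finite $t^k_n$ put $\lambda^k_n=L^k_{t^k_n}-L^k_{t^k_{n-1}}$, $b^k_n=\operatorname{sign}(\lambda^k_n)$ and $q^k_n=|\lambda^k_n|-\Delta$ (the overshoot). The bit $b^k_n$ is sent at time $\tau^k_n=t^k_n+q^k_n/r$ and reaches the fusion center at time $\tau^k_n+d_k$. The fusion center knows $\Delta$, $r$ and $d_k$. It decodes $\hat\lambda^k_n=b^k_n\big(\Delta+r(\tau^k_n-\lfloor\tau^k_n\rfloor)\big)$ and forms $$\hat L_t=\sum_{k=1}^K\ \sum_{n\ge1:\ \tau^k_n+d_k\le t}\hat\lambda^k_n .$$ For $\hat A,\hat B>0$ it stops at $\hat{\mathcal T}=\min\{t\in\mathbb N:\hat L_t\notin(-\hat B,\hat A)\}$ and declares $\mathsf H_1$ if $\hat L_{\hat{\mathcal T}}\ge\hat A$ and $\mathsf H_0$ if $\hat L_{\hat{\mathcal T}}\le-\hat B$. Assume that there is a constant $\theta\ge 0$ with $\theta<r$ such that, for all $k$ and $n$, almost surely under $\mathsf P_0$ and under $\mathsf P_1$, $q^k_n\le\theta$ whenever $t^k_n<\infty$. **Theorem.**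 The decentralized detector is order-2 asymptotically optimal. That is, with all of the above fixed: 1. $\mathsf E_i[\mathcal T]<\infty$ and $\mathsf E_i[\hat{\mathcal T}]<\infty$ for $i=0,1$ and all positive thresholds. 2. $\mathsf E_i[\hat{\mathcal T}]-\mathsf E_i[\mathcal T]=O(1)$ as $\alpha,\beta\to0$, for $i=0,1$. Precisely, there are constants $C$ and $\varepsilon>0$ such that, for all $\alpha,\beta\in(0,\varepsilon)$ and all thresholds $A,B,\hat A,\hat B>0$ for which both tests have exactly the error probabilities $\mathsf P_0(\text{declare }\mathsf H_1)=\alpha$ and $\mathsf P_1(\text{declare }\mathsf H_0)=\beta$, one has $|\mathsf E_i[\hat{\mathcal T}]-\mathsf E_i[\mathcal T]|\le C$ for $i=0,1$. 3. When $\alpha,\beta$ need not be attainable exactly: for every $M$ there are $C$ and $\varepsilon>0$ such that, for all $\alpha,\beta\in(0,\varepsilon)$ with $\beta|\log\alpha|\le M$ and $\alpha|\log\beta|\le M$, there are $\hat A,\hat B>0$ for which the decentralized detector has error probabilities at most $\alpha$ and $\beta$, and $\mathsf E_i[\hat{\mathcal T}]\le\mathsf E_i[\mathcal T]+C$ ($i=0,1$)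 for every centralized SPRT with positive thresholds and error probabilities at most $\alpha$ and $\beta$. -/

import Mathlib

open MeasureTheory ProbabilityTheory
open scoped ENNReal

noncomputable section

namespace LevelTriggered

/-- Local log-likelihood ratio of one sensor after `t` observations. `y s` is the observation with
number `s + 1`, and `f₀`, `f₁` are its densities under the two hypotheses. -/
def localLLR {Ω 𝓨 : Type*} (f₀ f₁ : 𝓨 → ℝ) (y : ℕ → Ω → 𝓨) (t : ℕ) (ω : Ω) : ℝ :=
  ∑ s ∈ Finset.range t, Real.log (f₁ (y s ω) / f₀ (y s ω))

/-! ### The sensor side, along one path `L` of the local LLR -/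

/-- Level-triggered sampling times: `t₀ = 0`, and the next sampling time is the first later time at
which `L` differs by at least `Δ` from its last sampled value (`⊤` if there is none). -/
def samplingTime (Δ : ℝ) (L : ℕ → ℝ) : ℕ → ℕ∞
  | 0 => 0
  | n + 1 => ⨅ (t : ℕ) (_ : samplingTime Δ L n < (t : ℕ∞) ∧
      Δ ≤ |L t - L (samplingTime Δ L n).toNat|), (t : ℕ∞)

/-! The quantities below, with index `n`, belong to the sample number `n + 1`. They are meaningful
only if that sample exists, that is, if `samplingTime Δ L (n + 1) ≠ ⊤`. -/

/-- The change of the local LLR between two consecutive sampling times. -/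
def increment (Δ : ℝ) (L : ℕ → ℝ) (n : ℕ) : ℝ :=
  L (samplingTime Δ L (n + 1)).toNat - L (samplingTime Δ L n).toNat

/-- The transmitted bit. -/
def signBit (Δ : ℝ) (L : ℕ → ℝ) (n : ℕ) : SignType :=
  SignType.sign (increment Δ L n)

/-- The overshoot over `Δ`, or below `-Δ`. -/
def overshoot (Δ : ℝ) (L : ℕ → ℝ) (n : ℕ) : ℝ :=
  |increment Δ L n| - Δ

/-- The transmission time: the sampling time plus the linearly encoded overshoot. -/
def transmissionTime (Δ r : ℝ) (L : ℕ → ℝ) (n : ℕ) : ℝ :=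
  ((samplingTime Δ L (n + 1)).toNat : ℝ) + overshoot Δ L n / r

/-- The arrival time at the fusion center, over a channel with deterministic delay `d`. -/
def arrivalTime (Δ r d : ℝ) (L : ℕ → ℝ) (n : ℕ) : ℝ :=
  transmissionTime Δ r L n + d

/-! ### The fusion center -/

/-- The LLR increment that the fusion center decodes from a bit `b` that arrives at time `a`: the
fractional part of the transmission time `a - d` gives back the overshoot. -/
def decode (Δ r d a : ℝ) (b : SignType) : ℝ :=
  (b : ℝ) * (Δ + r * Int.fract (a - d))

open Classical in
/-- The approximate local LLR at the fusion center at time `t`: the sum of the increments decoded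
from the bits that have arrived by time `t`. Sample number `n + 1` is taken at time `n + 1` at the
earliest, so only indices `n < t` can contribute. -/
def fusionLocalLLR (Δ r d : ℝ) (L : ℕ → ℝ) (t : ℕ) : ℝ :=
  ∑ n ∈ (Finset.range t).filter
      (fun n => samplingTime Δ L (n + 1) ≠ ⊤ ∧ arrivalTime Δ r d L n ≤ (t : ℝ)),
    decode Δ r d (arrivalTime Δ r d L n) (signBit Δ L n)

/-! ### Two-threshold tests, along one path `X` of the test statistic -/

/-- The first time at which `X` is outside `(-B, A)` (`⊤` if there is none). -/
def exitTime (A B : ℝ) (X : ℕ → ℝ) : ℕ∞ :=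
  ⨅ (t : ℕ) (_ : X t ∉ Set.Ioo (-B) A), (t : ℕ∞)

/-- The test stops and declares the hypothesis `H₁`. -/
def DeclaresH1 (A B : ℝ) (X : ℕ → ℝ) : Prop :=
  exitTime A B X ≠ ⊤ ∧ A ≤ X (exitTime A B X).toNat

/-- The test stops and declares the hypothesis `H₀`. -/
def DeclaresH0 (A B : ℝ) (X : ℕ → ℝ) : Prop :=
  exitTime A B X ≠ ⊤ ∧ X (exitTime A B X).toNat ≤ -B

/-- Probability of a false alarm of the test with statistic `X` and thresholds `-B`, `A`; `P 0` is
the probability measure under `H₀`. -/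
def falseAlarm {Ω : Type*} [MeasurableSpace Ω] (P : Fin 2 → Measure Ω) (X : ℕ → Ω → ℝ)
    (A B : ℝ) : ℝ :=
  (P 0).real {ω | DeclaresH1 A B (fun t => X t ω)}

/-- Probability of a missed detection; `P 1` is the probability measure under `H₁`. -/
def missedDetection {Ω : Type*} [MeasurableSpace Ω] (P : Fin 2 → Measure Ω) (X : ℕ → Ω → ℝ)
    (A B : ℝ) : ℝ :=
  (P 1).real {ω | DeclaresH0 A B (fun t => X t ω)}

/-- Average detection delay under `H i`. -/
def meanDelay {Ω : Type*} [MeasurableSpace Ω] (P : Fin 2 → Measure Ω) (X : ℕ → Ω → ℝ)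
    (A B : ℝ) (i : Fin 2) : ℝ≥0∞ :=
  ∫⁻ ω, (exitTime A B (fun t => X t ω) : ℝ≥0∞) ∂(P i)

/-! ### The test statistics of the two detectors -/

/-- The global LLR: the statistic of the centralized SPRT. -/
def centralLLR {Ω : Type*} {K : ℕ} {𝓨 : Fin K → Type*} (f : Fin 2 → (k : Fin K) → 𝓨 k → ℝ)
    (y : (k : Fin K) → ℕ → Ω → 𝓨 k) (t : ℕ) (ω : Ω) : ℝ :=
  ∑ k, localLLR (f 0 k) (f 1 k) (y k) t ω

/-- The approximate global LLR at the fusion center: the statistic of the decentralized detector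
with sampling threshold `Δ`, encoding slope `r` and channel delays `d k`. -/
def fusionLLR {Ω : Type*} {K : ℕ} {𝓨 : Fin K → Type*} (f : Fin 2 → (k : Fin K) → 𝓨 k → ℝ)
    (y : (k : Fin K) → ℕ → Ω → 𝓨 k) (Δ r : ℝ) (d : Fin K → ℝ) (t : ℕ) (ω : Ω) : ℝ :=
  ∑ k, fusionLocalLLR Δ r (d k) (fun s => localLLR (f 0 k) (f 1 k) (y k) s ω) t

end LevelTriggered

end

namespace LevelTriggered

open Filter Topology

/-! ### First entrance times -/

/-! The fusion statistic stays within a deterministic constant `D` of the true global LLR, and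
Wald's classical relations survive such a perturbation with errors that do not depend on the
thresholds.

The constant `D` arises as follows. An observation with |LLR| above `Δ + θ` at time 1 would itself
trigger a sample with overshoot above `θ`, so every increment of a local LLR is a.s. at most `Δ + θ`
in absolute value (`abs_apply_one_le_of_overshoot_le`, then equality of laws). Since `θ < r`, the
encoding shift is less than one time unit: decoding is exact and bits arrive in order
(`decode_arrivalTime`, `exists_fusionLocalLLR_eq`). The fusion center therefore holds a past sample
of the local LLR, and between that sample and the present only less than `Δ` plus boundedly many
bounded steps can be lost (`abs_fusionLocalLLR_sub_le`).

For any adapted statistic `X` within `D` of an LLR process with bounded steps and positive drift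
`μ`, the LLR at exit is within `R = c + 3 * D` of the crossed threshold. A change of measure then
gives the error probabilities up to factors `exp (±R)`, and optional stopping gives `μ` times the
mean delay up to `R`. These facts form `WaldBounds`. They apply to the SPRT, to the decentralized
test, and, after negating the LLR and swapping thresholds, under both hypotheses.

The rest is arithmetic. Equal error probabilities force thresholds within `2 * R`, hence delays
within `4 * R / μ`. With inequality constraints, the thresholds `-log α + R` and `-log β + R` meet
the constraints, while every admissible SPRT needs delay at least `(-log α - const) / μ` under `H₁`;
`β * |log α| ≤ M` absorbs the loss from the factor `1 - β`. `H₀` is symmetric. -/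

theorem iInf_natCast_eq_find {p : ℕ → Prop} [DecidablePred p] (h : ∃ t, p t) :
    (⨅ (t : ℕ) (_ : p t), (t : ℕ∞)) = (Nat.find h : ℕ∞) := by
  apply le_antisymm
  · exact iInf₂_le (Nat.find h) (Nat.find_spec h)
  · exact le_iInf₂ fun t ht => by exact_mod_cast Nat.find_min' h ht

theorem iInf_natCast_eq_top_iff {p : ℕ → Prop} :
    (⨅ (t : ℕ) (_ : p t), (t : ℕ∞)) = ⊤ ↔ ∀ t, ¬ p t := by
  simp [iInf_eq_top]

theorem iInf_natCast_eq_coe_iff {p : ℕ → Prop} {m : ℕ} :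
    (⨅ (t : ℕ) (_ : p t), (t : ℕ∞)) = (m : ℕ∞) ↔ p m ∧ ∀ u < m, ¬ p u := by
  classical
  by_cases h : ∃ t, p t
  · rw [iInf_natCast_eq_find h, Nat.cast_inj, Nat.find_eq_iff]
  · have h' : ∀ t, ¬ p t := fun t ht => h ⟨t, ht⟩
    rw [iInf_natCast_eq_top_iff.2 h']
    simp [h']

theorem coe_lt_iInf_natCast_iff {p : ℕ → Prop} {s : ℕ} :
    (s : ℕ∞) < (⨅ (t : ℕ) (_ : p t), (t : ℕ∞)) ↔ ∀ u ≤ s, ¬ p u := by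
  classical
  by_cases h : ∃ t, p t
  · rw [iInf_natCast_eq_find h, Nat.cast_lt, Nat.lt_find_iff]
  · have h' : ∀ t, ¬ p t := fun t ht => h ⟨t, ht⟩
    rw [iInf_natCast_eq_top_iff.2 h']
    simp [h']

/-! ### Level-triggered sampling along a path -/

section Path

variable {Δ θ r d φ : ℝ} {L : ℕ → ℝ}

theorem samplingTime_succ_eq_coe_iff {n m : ℕ} :
    samplingTime Δ L (n + 1) = m ↔ ∃ j : ℕ, samplingTime Δ L n = j ∧ j < m ∧
      Δ ≤ |L m - L j| ∧ ∀ u, j < u → u < m → |L u - L j| < Δ := by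
  rw [samplingTime, iInf_natCast_eq_coe_iff]
  constructor
  · rintro ⟨⟨h1, h2⟩, h3⟩
    obtain ⟨j, hj⟩ := ENat.ne_top_iff_exists.1 (ne_top_of_lt h1)
    rw [← hj] at h1 h2 h3 ⊢
    simp only [ENat.toNat_natCast, Nat.cast_lt, not_and, not_le] at h1 h2 h3
    exact ⟨j, rfl, h1, h2, fun u hu hum => h3 u hum hu⟩
  · rintro ⟨j, hj, h1, h2, h3⟩
    rw [hj]
    simp only [ENat.toNat_natCast, Nat.cast_lt, not_and, not_le]
    exact ⟨⟨h1, h2⟩, fun u hum hu => h3 u hu hum⟩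

theorem abs_sub_lt_of_lt_samplingTime {n j u : ℕ} (hj : samplingTime Δ L n = j) (hju : j < u)
    (hu : (u : ℕ∞) < samplingTime Δ L (n + 1)) : |L u - L j| < Δ := by
  rw [samplingTime, coe_lt_iInf_natCast_iff] at hu
  have := hu u le_rfl
  rw [hj] at this
  simpa [hju] using this

theorem exists_samplingTime_eq {n : ℕ} (h : samplingTime Δ L (n + 1) ≠ ⊤) :
    ∃ j m : ℕ, samplingTime Δ L n = j ∧ samplingTime Δ L (n + 1) = m ∧ j < m ∧
      Δ ≤ |L m - L j| := by
  obtain ⟨m, hm⟩ := ENat.ne_top_iff_exists.1 h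
  obtain ⟨j, hj, hjm, hΔ, -⟩ := samplingTime_succ_eq_coe_iff.1 hm.symm
  exact ⟨j, m, hj, hm.symm, hjm, hΔ⟩

theorem overshoot_nonneg {n : ℕ} (h : samplingTime Δ L (n + 1) ≠ ⊤) : 0 ≤ overshoot Δ L n := by
  obtain ⟨j, m, hj, hm, -, hΔ⟩ := exists_samplingTime_eq h
  simp only [overshoot, increment, hj, hm, ENat.toNat_natCast]
  linarith

theorem le_samplingTime (n : ℕ) : (n : ℕ∞) ≤ samplingTime Δ L n := by
  induction n with
  | zero => simp
  | succ n ih =>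
    by_cases h : samplingTime Δ L (n + 1) = ⊤
    · simp [h]
    · obtain ⟨j, m, hj, hm, hjm, -⟩ := exists_samplingTime_eq h
      rw [hj, Nat.cast_le] at ih
      rw [hm, Nat.cast_le]
      omega

theorem samplingTime_le_arrivalTime (hr : 0 < r) (hd : 0 ≤ d) {n m : ℕ}
    (hm : samplingTime Δ L (n + 1) = m) : (m : ℝ) ≤ arrivalTime Δ r d L n := by
  have h0 := overshoot_nonneg (hm ▸ ENat.natCast_ne_top m : samplingTime Δ L (n + 1) ≠ ⊤)
  have : 0 ≤ overshoot Δ L n / r := by positivity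
  simp only [arrivalTime, transmissionTime, hm, ENat.toNat_natCast]
  linarith

/-- The sampling time is an integer and the overshoot divided by `r` lies in `[0, 1)`, so the
fractional part recovers it exactly. With an overshoot of `r` or more it would wrap around. -/
theorem decode_arrivalTime (hr : 0 < r) {n : ℕ}
    (h : samplingTime Δ L (n + 1) ≠ ⊤) (hover : overshoot Δ L n < r) :
    decode Δ r d (arrivalTime Δ r d L n) (signBit Δ L n) = increment Δ L n := by
  have h0 := overshoot_nonneg h
  have hfract : Int.fract (arrivalTime Δ r d L n - d) = overshoot Δ L n / r := by
    rw [arrivalTime, add_sub_cancel_right, transmissionTime, Int.fract_natCast_add,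
      Int.fract_eq_self]
    exact ⟨by positivity, (div_lt_one hr).2 hover⟩
  rw [decode, hfract, mul_div_cancel₀ _ hr.ne', signBit]
  have : Δ + overshoot Δ L n = |increment Δ L n| := by rw [overshoot]; ring
  rw [this]
  exact sign_mul_abs _

/-- The fusion center holds the local LLR at the last sampling time whose bit has arrived. -/
theorem exists_fusionLocalLLR_eq (hθ : θ < r) (hr : 0 < r) (hd : 0 ≤ d)
    (hL : L 0 = 0)
    (hover : ∀ n, samplingTime Δ L (n + 1) ≠ ⊤ → overshoot Δ L n ≤ θ) (t : ℕ) :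
    ∃ N j : ℕ, samplingTime Δ L N = j ∧ j ≤ t ∧ fusionLocalLLR Δ r d L t = L j ∧
      (samplingTime Δ L (N + 1) ≠ ⊤ → (t : ℝ) < arrivalTime Δ r d L N) := by
  classical
  set p : ℕ → Prop := fun n => samplingTime Δ L (n + 1) ≠ ⊤ ∧ arrivalTime Δ r d L n ≤ (t : ℝ)
  have hpt : ∀ n, p n → n < t := by
    rintro n ⟨h1, h2⟩
    obtain ⟨j, m, hj, hm, hjm, -⟩ := exists_samplingTime_eq h1
    have h3 := (samplingTime_le_arrivalTime hr hd hm).trans h2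
    have h4 := le_samplingTime (Δ := Δ) (L := L) (n + 1)
    rw [hm, Nat.cast_le] at h4
    rw [Nat.cast_le] at h3
    omega
  -- Sampling times differ by at least 1 and the encoding shifts each bit by at most 1, so no bit
  -- overtakes an earlier one. The arrived indices form an initial segment, and the decoded
  -- increments telescope.
  have hdown : ∀ n, p (n + 1) → p n := by
    rintro n ⟨h1, h2⟩
    obtain ⟨j, m, hj, hm, hjm, -⟩ := exists_samplingTime_eq h1
    have h3 := (samplingTime_le_arrivalTime hr hd hm).trans h2
    have hne : samplingTime Δ L (n + 1) ≠ ⊤ := hj ▸ ENat.natCast_ne_top j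
    refine ⟨hne, ?_⟩
    have h5 : overshoot Δ L n / r ≤ 1 := (div_le_one hr).2 ((hover n hne).trans hθ.le)
    have h6 : 0 ≤ overshoot Δ L (n + 1) / r := div_nonneg (overshoot_nonneg h1) hr.le
    have h7 : (j : ℝ) + 1 ≤ m := by exact_mod_cast hjm
    simp only [arrivalTime, transmissionTime, hm, hj, ENat.toNat_natCast] at h2 ⊢
    linarith
  have hex : ∃ n, ¬ p n := ⟨t, fun h => (hpt t h).false⟩
  set N := Nat.find hex
  have hNot : ¬ p N := Nat.find_spec hex
  have hlt : ∀ n < N, p n := fun n hn => not_not.1 (Nat.find_min hex hn)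
  have hge : ∀ n, N ≤ n → ¬ p n := by
    intro n hn
    induction n, hn using Nat.le_induction with
    | base => exact hNot
    | succ n _ ih => exact fun h => ih (hdown n h)
  have hfilter : (Finset.range t).filter p = Finset.range N := by
    ext n
    simp only [Finset.mem_filter, Finset.mem_range]
    refine ⟨fun h => ?_, fun h => ⟨hpt n (hlt n h), hlt n h⟩⟩
    by_contra h'
    exact hge n (not_lt.1 h') h.2
  have hsum : fusionLocalLLR Δ r d L t = L (samplingTime Δ L N).toNat := by
    have h1 : fusionLocalLLR Δ r d L t = ∑ n ∈ Finset.range N, increment Δ L n := by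
      unfold fusionLocalLLR
      rw [← hfilter]
      refine Finset.sum_congr (by congr) fun n hn => ?_
      have hpn : p n := (Finset.mem_filter.1 hn).2
      exact decode_arrivalTime hr hpn.1 ((hover n hpn.1).trans_lt hθ)
    rw [h1]
    simp only [increment]
    rw [Finset.sum_range_sub (fun n => L (samplingTime Δ L n).toNat)]
    simp [samplingTime, hL]
  obtain ⟨j, hj, hjt⟩ : ∃ j : ℕ, samplingTime Δ L N = j ∧ j ≤ t := by
    rcases hN' : N with _ | N'
    · exact ⟨0, rfl, Nat.zero_le _⟩
    · obtain ⟨h1, h2⟩ := hlt N' (by omega)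
      obtain ⟨j, m, -, hm, -, -⟩ := exists_samplingTime_eq h1
      exact ⟨m, hm, by exact_mod_cast (samplingTime_le_arrivalTime hr hd hm).trans h2⟩
  refine ⟨N, j, hj, hjt, by rw [hsum, hj, ENat.toNat_natCast], fun hne => ?_⟩
  by_contra h'
  exact hNot ⟨hne, not_lt.1 h'⟩

theorem abs_sub_le_mul_of_abs_step_le (hstep : ∀ t, |L (t + 1) - L t| ≤ φ) (s k : ℕ) :
    |L (s + k) - L s| ≤ k * φ := by
  induction k with
  | zero => simp
  | succ k ih =>
    have := abs_sub_le (L (s + (k + 1))) (L (s + k)) (L s)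
    have := hstep (s + k)
    rw [add_assoc] at this
    push_cast
    linarith

/-- A bit needs at most `1 + d` time units from sampling to arrival. So at time `t - e`, with `e =
⌈d⌉₊ + 1`, the first missing sample had not yet been taken: the path was then within `Δ` of the
sample held, and at most `e` steps follow. -/
theorem abs_fusionLocalLLR_sub_le (hΔ : 0 < Δ) (hθ : θ < r) (hr : 0 < r) (hd : 0 ≤ d)
    (hL : L 0 = 0) (hstep : ∀ t, |L (t + 1) - L t| ≤ φ)
    (hover : ∀ n, samplingTime Δ L (n + 1) ≠ ⊤ → overshoot Δ L n ≤ θ) (t : ℕ) :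
    |fusionLocalLLR Δ r d L t - L t| ≤ Δ + (⌈d⌉₊ + 1 : ℕ) * φ := by
  obtain ⟨N, j, hj, hjt, heq, harr⟩ := exists_fusionLocalLLR_eq hθ hr hd hL hover t
  set e := ⌈d⌉₊ + 1 with he
  have hφ : 0 ≤ φ := (abs_nonneg _).trans (hstep 0)
  rw [heq, abs_sub_comm]
  -- The subtraction is truncated, so the case `t < e` falls under the first alternative.
  by_cases hcase : t - e ≤ j
  · obtain ⟨k, rfl⟩ := Nat.exists_eq_add_of_le hjt
    have h1 := abs_sub_le_mul_of_abs_step_le hstep j k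
    have h2 : (k : ℝ) * φ ≤ e * φ := by
      gcongr
      omega
    linarith
  · rw [not_le] at hcase
    have h1 : |L (t - e) - L j| < Δ := by
      refine abs_sub_lt_of_lt_samplingTime hj hcase ?_
      by_cases htop : samplingTime Δ L (N + 1) = ⊤
      · rw [htop]
        exact ENat.natCast_lt_top _
      · obtain ⟨j', m, -, hm, -, -⟩ := exists_samplingTime_eq htop
        have h2 := harr htop
        have h3 : overshoot Δ L N / r ≤ 1 := (div_le_one hr).2 ((hover N htop).trans hθ.le)
        simp only [arrivalTime, transmissionTime, hm, ENat.toNat_natCast] at h2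
        rw [hm, Nat.cast_lt]
        have h4 : (t : ℝ) < m + e := by
          rw [he]
          push_cast
          linarith [Nat.le_ceil d]
        have h5 : t < m + e := by exact_mod_cast h4
        omega
    have h2 := abs_sub_le_mul_of_abs_step_le hstep (t - e) e
    rw [Nat.sub_add_cancel (by omega)] at h2
    have := abs_sub_le (L t) (L (t - e)) (L j)
    linarith

/-- A larger first step would make time 1 the first sampling time, with overshoot above `θ`. -/
theorem abs_apply_one_le_of_overshoot_le (hL : L 0 = 0) (hθ : 0 ≤ θ)
    (hover : samplingTime Δ L 1 ≠ ⊤ → overshoot Δ L 0 ≤ θ) : |L 1| ≤ Δ + θ := by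
  by_contra! h
  have h1 : samplingTime Δ L (0 + 1) = (1 : ℕ) :=
    samplingTime_succ_eq_coe_iff.2 ⟨0, rfl, one_pos, by simp [hL]; linarith, by omega⟩
  have h2 := hover (h1 ▸ ENat.natCast_ne_top 1)
  rw [overshoot, increment, h1] at h2
  simp [samplingTime, hL] at h2
  linarith

end Path

/-! ### The fusion statistic is adapted -/

section Measurability

variable {Ω : Type*} {L : ℕ → Ω → ℝ} {Δ r d : ℝ} {t : ℕ}

/-- Measurability is required only up to `t`, so that the σ-algebra can be that of the observations
up to time `t`; this is how adaptedness is obtained. -/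
theorem measurableSet_samplingTime_eq [MeasurableSpace Ω] (hL : ∀ u ≤ t, Measurable (L u))
    (n : ℕ) {m : ℕ} (hm : m ≤ t) :
    MeasurableSet {ω | samplingTime Δ (fun s => L s ω) n = m} := by
  induction n generalizing m with
  | zero => simp only [samplingTime, MeasurableSet.const]
  | succ n ih =>
    simp only [samplingTime_succ_eq_coe_iff]
    have : {ω | ∃ j : ℕ, samplingTime Δ (fun s => L s ω) n = j ∧ j < m ∧ Δ ≤ |L m ω - L j ω| ∧
        ∀ u, j < u → u < m → |L u ω - L j ω| < Δ} =
        ⋃ j ∈ Finset.range m, ({ω | samplingTime Δ (fun s => L s ω) n = j} ∩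
          ({ω | Δ ≤ |L m ω - L j ω|} ∩ ⋂ u ∈ Finset.Ioo j m, {ω | |L u ω - L j ω| < Δ})) := by
      ext ω
      simp only [Set.mem_ofPred_eq, Set.mem_iUnion, Set.mem_inter_iff, Set.mem_iInter,
        Finset.mem_range, Finset.mem_Ioo]
      constructor
      · rintro ⟨j, h1, h2, h3, h4⟩
        exact ⟨j, h2, h1, h3, fun u hu => h4 u hu.1 hu.2⟩
      · rintro ⟨j, h2, h1, h3, h4⟩
        exact ⟨j, h1, h2, h3, fun u h5 h6 => h4 u ⟨h5, h6⟩⟩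
    rw [this]
    refine Finset.measurableSet_biUnion _ fun j hj => ?_
    have hjm := Finset.mem_range.1 hj
    refine (ih (by omega)).inter (MeasurableSet.inter ?_ ?_)
    · exact measurableSet_le measurable_const ((hL m hm).sub (hL j (by omega))).abs
    · refine Finset.measurableSet_biInter _ fun u hu => ?_
      have := Finset.mem_Ioo.1 hu
      exact measurableSet_lt ((hL u (by omega)).sub (hL j (by omega))).abs measurable_const

open Classical in
/-- Only the path up to time `t` enters the fusion statistic at time `t`. -/
theorem fusionLocalLLR_eq_sum (hr : 0 < r) (hd : 0 ≤ d) (L : ℕ → ℝ) (t : ℕ) :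
    fusionLocalLLR Δ r d L t = ∑ n ∈ Finset.range t, ∑ j ∈ Finset.range (t + 1),
      ∑ m ∈ Finset.range (t + 1),
        if samplingTime Δ L n = j ∧ samplingTime Δ L (n + 1) = m ∧
            m + (|L m - L j| - Δ) / r + d ≤ t then
          decode Δ r d (m + (|L m - L j| - Δ) / r + d) (SignType.sign (L m - L j)) else 0 := by
  rw [fusionLocalLLR, Finset.sum_filter]
  refine Finset.sum_congr rfl fun n _ => ?_
  by_cases h : samplingTime Δ L (n + 1) ≠ ⊤ ∧ arrivalTime Δ r d L n ≤ t
  · rw [if_pos h]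
    obtain ⟨j₀, m₀, hj, hm, hjm, -⟩ := exists_samplingTime_eq h.1
    have hmt : m₀ ≤ t := by exact_mod_cast (samplingTime_le_arrivalTime hr hd hm).trans h.2
    have harr := h.2
    rw [Finset.sum_eq_single_of_mem j₀ (Finset.mem_range.2 (by omega)),
      Finset.sum_eq_single_of_mem m₀ (Finset.mem_range.2 (by omega))]
    · simp only [arrivalTime, transmissionTime, overshoot, increment, signBit, hj, hm,
        ENat.toNat_natCast] at harr ⊢
      simp [harr]
    · intro m _ hne
      rw [if_neg]
      rintro ⟨-, h2, -⟩
      rw [hm, Nat.cast_inj] at h2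
      exact hne h2.symm
    · intro j _ hne
      refine Finset.sum_eq_zero fun m _ => ?_
      rw [if_neg]
      rintro ⟨h2, -⟩
      rw [hj, Nat.cast_inj] at h2
      exact hne h2.symm
  · rw [if_neg h]
    symm
    refine Finset.sum_eq_zero fun j _ => Finset.sum_eq_zero fun m _ => ?_
    rw [if_neg]
    rintro ⟨hj, hm, hle⟩
    refine h ⟨hm ▸ ENat.natCast_ne_top m, ?_⟩
    simpa only [arrivalTime, transmissionTime, overshoot, increment, hj, hm, ENat.toNat_natCast]
      using hle

theorem measurable_fusionLocalLLR [MeasurableSpace Ω] (hr : 0 < r) (hd : 0 ≤ d)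
    (hL : ∀ u ≤ t, Measurable (L u)) :
    Measurable fun ω => fusionLocalLLR Δ r d (fun s => L s ω) t := by
  classical
  simp only [fusionLocalLLR_eq_sum hr hd]
  refine Finset.measurable_sum _ fun n _ => Finset.measurable_sum _ fun j hj =>
    Finset.measurable_sum _ fun m hm => ?_
  have hj' : j ≤ t := by have := Finset.mem_range.1 hj; omega
  have hm' : m ≤ t := by have := Finset.mem_range.1 hm; omega
  have hdiff : Measurable fun ω => L m ω - L j ω := (hL m hm').sub (hL j hj')
  have ha : Measurable fun ω => (m : ℝ) + (|L m ω - L j ω| - Δ) / r + d :=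
    (((hdiff.abs.sub_const Δ).div_const r).const_add _).add_const d
  refine Measurable.ite ?_ ?_ measurable_const
  · exact (measurableSet_samplingTime_eq hL n hj').inter
      ((measurableSet_samplingTime_eq hL (n + 1) hm').inter
        (measurableSet_le ha measurable_const))
  · have hsign : Measurable fun x : ℝ => ((SignType.sign x : SignType) : ℝ) := by
      have : (fun x : ℝ => ((SignType.sign x : SignType) : ℝ)) =
          fun x => if 0 < x then 1 else if x < 0 then -1 else 0 := by
        ext x
        rw [sign_apply]
        split_ifs <;> simp
      rw [this]
      exact Measurable.ite measurableSet_Ioi measurable_const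
        (Measurable.ite measurableSet_Iio measurable_const measurable_const)
    exact (hsign.comp hdiff).mul
      ((measurable_fract.comp (ha.sub_const d)).const_mul r |>.const_add Δ)

end Measurability

end LevelTriggered

namespace LevelTriggered

open Filter Topology

/-! ### Exit times along a path -/

section ExitTime

variable {A B : ℝ} {X : ℕ → ℝ}

theorem exitTime_eq_coe_iff {n : ℕ} :
    exitTime A B X = n ↔ X n ∉ Set.Ioo (-B) A ∧ ∀ u < n, X u ∈ Set.Ioo (-B) A := by
  simp only [exitTime, iInf_natCast_eq_coe_iff, not_not]

theorem coe_lt_exitTime_iff {n : ℕ} :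
    (n : ℕ∞) < exitTime A B X ↔ ∀ u ≤ n, X u ∈ Set.Ioo (-B) A := by
  simp only [exitTime, coe_lt_iInf_natCast_iff, not_not]

theorem declaresH1_iff :
    DeclaresH1 A B X ↔ ∃ n : ℕ, (∀ u < n, X u ∈ Set.Ioo (-B) A) ∧ A ≤ X n := by
  constructor
  · rintro ⟨h1, h2⟩
    obtain ⟨n, hn⟩ := ENat.ne_top_iff_exists.1 h1
    rw [← hn, ENat.toNat_natCast] at h2
    exact ⟨n, (exitTime_eq_coe_iff.1 hn.symm).2, h2⟩
  · rintro ⟨n, h1, h2⟩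
    have hn : exitTime A B X = n := exitTime_eq_coe_iff.2 ⟨fun h => h.2.not_ge h2, h1⟩
    exact ⟨hn ▸ ENat.natCast_ne_top n, by rwa [hn, ENat.toNat_natCast]⟩

/-- This symmetry and the next two reduce all statements under `H₀` to those under `H₁`. -/
theorem exitTime_neg : exitTime B A (fun t => -X t) = exitTime A B X := by
  simp only [exitTime, Set.mem_Ioo, neg_lt_neg_iff, neg_lt, and_comm]

theorem declaresH1_neg : DeclaresH1 B A (fun t => -X t) ↔ DeclaresH0 A B X := by
  simp only [DeclaresH1, DeclaresH0, exitTime_neg, le_neg]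

theorem declaresH0_neg : DeclaresH0 B A (fun t => -X t) ↔ DeclaresH1 A B X := by
  simp only [DeclaresH1, DeclaresH0, exitTime_neg, neg_le_neg_iff]

theorem declaresH1_or_declaresH0 (h : exitTime A B X ≠ ⊤) :
    DeclaresH1 A B X ∨ DeclaresH0 A B X := by
  obtain ⟨n, hn⟩ := ENat.ne_top_iff_exists.1 h
  have h1 := (exitTime_eq_coe_iff.1 hn.symm).1
  rw [Set.mem_Ioo, not_and_or, not_lt, not_lt] at h1
  rw [DeclaresH1, DeclaresH0, ← hn]
  exact h1.symm.imp (fun h => ⟨ENat.natCast_ne_top n, h⟩) (fun h => ⟨ENat.natCast_ne_top n, h⟩)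

theorem not_declaresH1_and_declaresH0 (hA : 0 < A) (hB : 0 < B) :
    ¬ (DeclaresH1 A B X ∧ DeclaresH0 A B X) := by
  rintro ⟨⟨-, h1⟩, -, h2⟩
  linarith

/-- Pointwise form of the tail-sum formula for the mean exit time, valid also for `⊤`. -/
theorem toENNReal_eq_tsum (N : ℕ∞) :
    (N : ℝ≥0∞) = ∑' n : ℕ, if (n : ℕ∞) < N then (1 : ℝ≥0∞) else 0 := by
  induction N using ENat.recTopCoe with
  | top => simp
  | coe m =>
    rw [tsum_eq_sum (s := Finset.range m)]
    · rw [Finset.sum_congr rfl (g := fun _ => (1 : ℝ≥0∞))]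
      · simp
      · intro n hn
        simpa using hn
    · intro n hn
      simpa using hn

end ExitTime

/-! ### Log-likelihood ratio processes with bounded increments -/

section Model

variable {Ω : Type*} {mΩ : MeasurableSpace Ω}

/-- `L` is the log-likelihood ratio process of `P` against `Q` along the filtration `F`, with
increments that are bounded by `c` and have conditional mean `μ > 0` under `P`. -/
structure IsLLRProcess (P Q : Measure Ω) (F : Filtration ℕ mΩ) (L : ℕ → Ω → ℝ) (c μ : ℝ) :
    Prop where
  zero : ∀ ω, L 0 ω = 0
  adapted : ∀ n, Measurable[F n] (L n)
  abs_step_le : ∀ n, ∀ᵐ ω ∂P, |L (n + 1) ω - L n ω| ≤ c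
  drift_pos : 0 < μ
  setIntegral_step : ∀ n E, MeasurableSet[F n] E →
    ∫ ω in E, (L (n + 1) ω - L n ω) ∂P = μ * P.real E
  density : ∀ n E, MeasurableSet[F n] E →
    Q E = ∫⁻ ω in E, ENNReal.ofReal (Real.exp (-L n ω)) ∂P

/-- `X` is an adapted statistic that stays within `D` of `L`. -/
structure IsApproximation (P : Measure Ω) (F : Filtration ℕ mΩ) (L X : ℕ → Ω → ℝ) (D : ℝ) :
    Prop where
  zero : ∀ ω, X 0 ω = 0
  adapted : ∀ n, Measurable[F n] (X n)
  abs_sub_le : ∀ n, ∀ᵐ ω ∂P, |X n ω - L n ω| ≤ D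

variable {P Q : Measure Ω} {F : Filtration ℕ mΩ} {L X : ℕ → Ω → ℝ} {c μ D A B : ℝ}

theorem IsApproximation.neg (h : IsApproximation P F L X D) :
    IsApproximation P F (fun n ω => -L n ω) (fun n ω => -X n ω) D where
  zero ω := by simp [h.zero]
  adapted n := (h.adapted n).neg
  abs_sub_le n := by
    filter_upwards [h.abs_sub_le n] with ω hω
    rwa [← neg_sub', abs_neg]

/-! ### Measurability of exit events -/

theorem IsApproximation.measurableSet_mem_Ioo (h : IsApproximation P F L X D) (u : ℕ) :
    MeasurableSet[F u] {ω | X u ω ∈ Set.Ioo (-B) A} :=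
  h.adapted u measurableSet_Ioo

theorem IsApproximation.measurableSet_forall_lt (h : IsApproximation P F L X D) (n : ℕ) :
    MeasurableSet[F n] {ω | ∀ u < n, X u ω ∈ Set.Ioo (-B) A} := by
  have : {ω | ∀ u < n, X u ω ∈ Set.Ioo (-B) A} =
      ⋂ u ∈ Finset.range n, {ω | X u ω ∈ Set.Ioo (-B) A} := by
    ext ω
    simp
  rw [this]
  exact Finset.measurableSet_biInter _ fun u hu =>
    F.mono (Finset.mem_range.1 hu).le _ (h.measurableSet_mem_Ioo u)

theorem IsApproximation.measurableSet_lt_exitTime (h : IsApproximation P F L X D) (n : ℕ) :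
    MeasurableSet[F n] {ω | (n : ℕ∞) < exitTime A B (fun t => X t ω)} := by
  have : {ω | (n : ℕ∞) < exitTime A B (fun t => X t ω)} =
      {ω | ∀ u < n, X u ω ∈ Set.Ioo (-B) A} ∩ {ω | X n ω ∈ Set.Ioo (-B) A} := by
    ext ω
    simp only [Set.mem_ofPred_eq, coe_lt_exitTime_iff, Set.mem_inter_iff]
    exact ⟨fun h => ⟨fun u hu => h u hu.le, h n le_rfl⟩,
      fun h u hu => hu.lt_or_eq.elim (h.1 u) fun hun => hun ▸ h.2⟩
  rw [this]
  exact (h.measurableSet_forall_lt n).inter (h.measurableSet_mem_Ioo n)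

theorem IsApproximation.measurableSet_exit_above (h : IsApproximation P F L X D) (n : ℕ) :
    MeasurableSet[F n] {ω | (∀ u < n, X u ω ∈ Set.Ioo (-B) A) ∧ A ≤ X n ω} :=
  (h.measurableSet_forall_lt n).inter (h.adapted n measurableSet_Ici)

theorem setOf_declaresH1_eq_iUnion : {ω | DeclaresH1 A B (fun t => X t ω)} =
    ⋃ n, {ω | (∀ u < n, X u ω ∈ Set.Ioo (-B) A) ∧ A ≤ X n ω} := by
  ext ω
  simp [declaresH1_iff]

theorem pairwise_disjoint_exit_above : Pairwise (Function.onFun Disjoint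
    fun n => {ω | (∀ u < n, X u ω ∈ Set.Ioo (-B) A) ∧ A ≤ X n ω}) := by
  intro m n hmn
  rw [Function.onFun, Set.disjoint_left]
  rintro ω ⟨h1, h2⟩ ⟨h3, h4⟩
  rcases hmn.lt_or_gt with h | h
  · exact ((h3 m h).2.trans_le h2).false
  · exact ((h1 n h).2.trans_le h4).false

theorem IsApproximation.measurableSet_declaresH1 (h : IsApproximation P F L X D) :
    MeasurableSet {ω | DeclaresH1 A B (fun t => X t ω)} := by
  rw [setOf_declaresH1_eq_iUnion]
  exact MeasurableSet.iUnion fun n => F.le n _ (h.measurableSet_exit_above n)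

theorem IsApproximation.measurableSet_declaresH0 (h : IsApproximation P F L X D) :
    MeasurableSet {ω | DeclaresH0 A B (fun t => X t ω)} := by
  simp only [← declaresH1_neg]
  exact h.neg.measurableSet_declaresH1

/-! #### The overshoot of the test statistic -/

/-- One step before the exit `X` was still below `A`, hence `L` below `A + D`, and one step adds at
most `c`. The exit is not at time 0 because `X` starts at 0. The constant is not sharp. -/
theorem IsLLRProcess.ae_abs_sub_le_of_exit_above (hL : IsLLRProcess P Q F L c μ)
    (hX : IsApproximation P F L X D) (hA : 0 < A) :
    ∀ᵐ ω ∂P, ∀ n : ℕ, (∀ u < n, X u ω ∈ Set.Ioo (-B) A) → A ≤ X n ω →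
      |L n ω - A| ≤ c + 3 * D := by
  filter_upwards [ae_all_iff.2 hL.abs_step_le, ae_all_iff.2 hX.abs_sub_le] with ω hstep hsub
  intro n hn hAn
  rcases n with _ | n
  · rw [hX.zero] at hAn
    linarith
  · have h1 := abs_le.1 (hstep n)
    have h2 := abs_le.1 (hsub n)
    have h3 := abs_le.1 (hsub (n + 1))
    have h4 := (hn n (Nat.lt_succ_self n)).2
    rw [abs_le]
    constructor <;> linarith

theorem IsLLRProcess.ae_abs_add_le_of_exit_below (hL : IsLLRProcess P Q F L c μ)
    (hX : IsApproximation P F L X D) (hB : 0 < B) :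
    ∀ᵐ ω ∂P, ∀ n : ℕ, (∀ u < n, X u ω ∈ Set.Ioo (-B) A) → X n ω ≤ -B →
      |L n ω + B| ≤ c + 3 * D := by
  filter_upwards [ae_all_iff.2 hL.abs_step_le, ae_all_iff.2 hX.abs_sub_le] with ω hstep hsub
  intro n hn hAn
  rcases n with _ | n
  · rw [hX.zero] at hAn
    linarith
  · have h1 := abs_le.1 (hstep n)
    have h2 := abs_le.1 (hsub n)
    have h3 := abs_le.1 (hsub (n + 1))
    have h4 := (hn n (Nat.lt_succ_self n)).1
    rw [abs_le]
    constructor <;> linarith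

/-! #### Wald's likelihood ratio inequalities -/

/-- Split the event by the exit time `n`. Each piece lies in `F n`, where `Q` has density `exp (-L
n)` with respect to `P`, and there `L n` is within `c + 3 * D` of `A`. -/
theorem IsLLRProcess.measure_declaresH1_bounds (hL : IsLLRProcess P Q F L c μ)
    (hX : IsApproximation P F L X D) (hA : 0 < A) :
    ENNReal.ofReal (Real.exp (-A - (c + 3 * D))) * P {ω | DeclaresH1 A B (fun t => X t ω)} ≤
        Q {ω | DeclaresH1 A B (fun t => X t ω)} ∧
      Q {ω | DeclaresH1 A B (fun t => X t ω)} ≤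
        ENNReal.ofReal (Real.exp (-A + (c + 3 * D))) *
          P {ω | DeclaresH1 A B (fun t => X t ω)} := by
  have hae := hL.ae_abs_sub_le_of_exit_above (B := B) hX hA
  have hm n : MeasurableSet {ω | (∀ u < n, X u ω ∈ Set.Ioo (-B) A) ∧ A ≤ X n ω} :=
    F.le n _ (hX.measurableSet_exit_above n)
  rw [setOf_declaresH1_eq_iUnion, measure_iUnion pairwise_disjoint_exit_above hm,
    measure_iUnion pairwise_disjoint_exit_above hm, ← ENNReal.tsum_mul_left,
    ← ENNReal.tsum_mul_left]
  constructor <;> refine ENNReal.tsum_le_tsum fun n => ?_ <;>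
    rw [hL.density n _ (hX.measurableSet_exit_above n), ← setLIntegral_const]
  · refine setLIntegral_mono_ae' (hm n) ?_
    filter_upwards [hae] with ω hω hmem
    have := abs_le.1 (hω n hmem.1 hmem.2)
    gcongr
    linarith
  · refine setLIntegral_mono_ae' (hm n) ?_
    filter_upwards [hae] with ω hω hmem
    have := abs_le.1 (hω n hmem.1 hmem.2)
    gcongr
    linarith

/-! #### Wald's identity for the exit time -/

theorem IsLLRProcess.measurable (hL : IsLLRProcess P Q F L c μ) (n : ℕ) : Measurable (L n) :=
  (hL.adapted n).mono (F.le n) le_rfl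

theorem IsLLRProcess.integrable_step [IsProbabilityMeasure P]
    (hL : IsLLRProcess P Q F L c μ) (n : ℕ) :
    Integrable (fun ω => L (n + 1) ω - L n ω) P :=
  Integrable.of_bound ((hL.measurable _).sub (hL.measurable _)).aestronglyMeasurable c
    (hL.abs_step_le n)

/-- The process `L`, stopped when `X` leaves `(-B, A)`. -/
noncomputable def stoppedLLR (A B : ℝ) (L X : ℕ → Ω → ℝ) (n : ℕ) (ω : Ω) : ℝ :=
  ∑ s ∈ Finset.range n, {ω | (s : ℕ∞) < exitTime A B (fun t => X t ω)}.indicator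
    (fun ω => L (s + 1) ω - L s ω) ω

/-- The witness `m` is the minimum of `n` and the exit time. -/
theorem stoppedLLR_eq (hL : ∀ ω, L 0 ω = 0) (n : ℕ) (ω : Ω) :
    ∃ m : ℕ, m ≤ n ∧ (m : ℕ∞) ≤ exitTime A B (fun t => X t ω) ∧
      (m = n ∨ exitTime A B (fun t => X t ω) = m) ∧ stoppedLLR A B L X n ω = L m ω := by
  induction n with
  | zero => exact ⟨0, le_rfl, by simp, Or.inl rfl, by simp [stoppedLLR, hL]⟩
  | succ n ih =>
    obtain ⟨m, hmn, hm, hor, heq⟩ := ih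
    rw [stoppedLLR, Finset.sum_range_succ, ← stoppedLLR]
    by_cases h : (n : ℕ∞) < exitTime A B (fun t => X t ω)
    · have hmn' : m = n := by
        refine hor.resolve_right fun h' => ?_
        rw [h', Nat.cast_lt] at h
        omega
      subst hmn'
      refine ⟨m + 1, le_rfl, ?_, Or.inl rfl, ?_⟩
      · exact_mod_cast Order.add_one_le_of_lt h
      · rw [Set.indicator_of_mem (by exact h), heq]
        ring
    · refine ⟨m, by omega, hm, Or.inr ?_, ?_⟩
      · refine le_antisymm ?_ hm
        rcases hor with rfl | h'
        · exact not_lt.1 h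
        · exact h'.le
      · rw [Set.indicator_of_notMem (by exact h), heq, add_zero]

theorem IsLLRProcess.ae_abs_stoppedLLR_le (hL : IsLLRProcess P Q F L c μ)
    (hX : IsApproximation P F L X D) (hA : 0 < A) (hB : 0 < B) :
    ∀ᵐ ω ∂P, ∀ n, |stoppedLLR A B L X n ω| ≤ A + B + c + D := by
  filter_upwards [ae_all_iff.2 hL.abs_step_le, ae_all_iff.2 hX.abs_sub_le] with ω hstep hsub
  intro n
  obtain ⟨m, hmn, hm, hor, heq⟩ := stoppedLLR_eq (A := A) (B := B) (X := X) hL.zero n ω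
  rw [heq]
  have hc : 0 ≤ c := (abs_nonneg _).trans (hstep 0)
  have hD : 0 ≤ D := (abs_nonneg _).trans (hsub 0)
  rcases m with _ | m
  · rw [hL.zero, abs_zero]
    positivity
  · have hlt : (m : ℕ∞) < exitTime A B (fun t => X t ω) :=
      lt_of_lt_of_le (by exact_mod_cast Nat.lt_succ_self m) hm
    have h1 := coe_lt_exitTime_iff.1 hlt m le_rfl
    have h2 := abs_le.1 (hstep m)
    have h3 := abs_le.1 (hsub m)
    have h4 := h1.1
    have h5 := h1.2
    rw [abs_le]
    constructor <;> linarith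

theorem IsLLRProcess.measurable_stoppedLLR (hL : IsLLRProcess P Q F L c μ)
    (hX : IsApproximation P F L X D) (n : ℕ) : Measurable (stoppedLLR A B L X n) := by
  unfold stoppedLLR
  exact Finset.measurable_sum _ fun s _ => ((hL.measurable _).sub (hL.measurable _)).indicator
    (F.le s _ (hX.measurableSet_lt_exitTime s))

theorem IsLLRProcess.integral_stoppedLLR [IsProbabilityMeasure P]
    (hL : IsLLRProcess P Q F L c μ)
    (hX : IsApproximation P F L X D) (n : ℕ) :
    ∫ ω, stoppedLLR A B L X n ω ∂P =
      μ * ∑ s ∈ Finset.range n, P.real {ω | (s : ℕ∞) < exitTime A B (fun t => X t ω)} := by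
  have hm s := F.le s _ (hX.measurableSet_lt_exitTime (A := A) (B := B) s)
  unfold stoppedLLR
  rw [integral_finsetSum _ fun s _ => (hL.integrable_step s).indicator (hm s), Finset.mul_sum]
  refine Finset.sum_congr rfl fun s _ => ?_
  rw [integral_indicator (hm s), hL.setIntegral_step s _ (hX.measurableSet_lt_exitTime s)]

theorem IsApproximation.lintegral_exitTime (hX : IsApproximation P F L X D) :
    ∫⁻ ω, (exitTime A B (fun t => X t ω) : ℝ≥0∞) ∂P =
      ∑' s : ℕ, P {ω | (s : ℕ∞) < exitTime A B (fun t => X t ω)} := by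
  classical
  have hm s := F.le s _ (hX.measurableSet_lt_exitTime (A := A) (B := B) s)
  simp only [toENNReal_eq_tsum (exitTime A B _)]
  rw [lintegral_tsum fun s => (Measurable.ite (hm s) measurable_const measurable_const).aemeasurable]
  refine tsum_congr fun s => ?_
  rw [← lintegral_indicator_one (hm s)]
  refine lintegral_congr fun ω => ?_
  by_cases h : (s : ℕ∞) < exitTime A B (fun t => X t ω) <;> simp [h]

/-- The stopped process is bounded uniformly in `n`, while its mean is `μ` times the `n`-th partial
sum of the tail series of the exit time. As `μ > 0`, the series converges. -/
theorem IsLLRProcess.lintegral_exitTime_ne_top [IsProbabilityMeasure P]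
    (hL : IsLLRProcess P Q F L c μ)
    (hX : IsApproximation P F L X D) (hA : 0 < A) (hB : 0 < B) :
    ∫⁻ ω, (exitTime A B (fun t => X t ω) : ℝ≥0∞) ∂P ≠ ⊤ := by
  rw [hX.lintegral_exitTime]
  refine ne_top_of_le_ne_top (b := ENNReal.ofReal ((A + B + c + D) / μ)) ENNReal.ofReal_ne_top ?_
  refine ENNReal.tsum_le_of_sum_range_le fun n => ?_
  have h1 : ∫ ω, stoppedLLR A B L X n ω ∂P ≤ A + B + c + D := by
    have h2 := norm_integral_le_of_norm_le_const (μ := P) (f := stoppedLLR A B L X n)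
      (C := A + B + c + D)
      (by filter_upwards [hL.ae_abs_stoppedLLR_le hX hA hB] with ω hω using hω n)
    rw [probReal_univ, mul_one] at h2
    exact (le_abs_self _).trans h2
  rw [hL.integral_stoppedLLR hX] at h1
  have h3 : ∑ s ∈ Finset.range n, P {ω | (s : ℕ∞) < exitTime A B (fun t => X t ω)} =
      ENNReal.ofReal (∑ s ∈ Finset.range n,
        P.real {ω | (s : ℕ∞) < exitTime A B (fun t => X t ω)}) := by
    rw [ENNReal.ofReal_sum_of_nonneg fun _ _ => measureReal_nonneg]
    exact Finset.sum_congr rfl fun s _ => (ofReal_measureReal).symm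
  rw [h3]
  gcongr
  rw [le_div_iff₀' hL.drift_pos]
  exact h1

theorem IsApproximation.measurable_exitTime (hX : IsApproximation P F L X D) :
    Measurable fun ω => (exitTime A B (fun t => X t ω) : ℝ≥0∞) := by
  classical
  have hm s := F.le s _ (hX.measurableSet_lt_exitTime (A := A) (B := B) s)
  simp only [toENNReal_eq_tsum (exitTime A B _)]
  exact Measurable.tsum fun s => Measurable.ite (hm s) measurable_const measurable_const

theorem IsLLRProcess.ae_exitTime_ne_top [IsProbabilityMeasure P]
    (hL : IsLLRProcess P Q F L c μ)
    (hX : IsApproximation P F L X D) (hA : 0 < A) (hB : 0 < B) :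
    ∀ᵐ ω ∂P, exitTime A B (fun t => X t ω) ≠ ⊤ := by
  filter_upwards [ae_lt_top hX.measurable_exitTime (hL.lintegral_exitTime_ne_top hX hA hB)]
    with ω hω
  exact ENat.toENNReal_ne_top.1 hω.ne

theorem IsLLRProcess.real_declares_add [IsProbabilityMeasure P]
    (hL : IsLLRProcess P Q F L c μ)
    (hX : IsApproximation P F L X D) (hA : 0 < A) (hB : 0 < B) :
    P.real {ω | DeclaresH1 A B (fun t => X t ω)} +
      P.real {ω | DeclaresH0 A B (fun t => X t ω)} = 1 := by
  rw [← measureReal_union _ hX.measurableSet_declaresH0, ← probReal_univ (μ := P)]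
  · refine measureReal_congr (eventuallyEq_univ.2 ?_)
    filter_upwards [hL.ae_exitTime_ne_top hX hA hB] with ω hω
    exact declaresH1_or_declaresH0 hω
  · rw [Set.disjoint_left]
    exact fun ω h1 h2 => not_declaresH1_and_declaresH0 hA hB ⟨h1, h2⟩

/-- Wald's identity, with `L` at the exit time replaced by the threshold that is crossed. -/
theorem IsLLRProcess.abs_drift_mul_meanDelay_sub_le [IsProbabilityMeasure P]
    (hL : IsLLRProcess P Q F L c μ)
    (hX : IsApproximation P F L X D) (hA : 0 < A) (hB : 0 < B) :
    |μ * (∫⁻ ω, (exitTime A B (fun t => X t ω) : ℝ≥0∞) ∂P).toReal -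
      (A * P.real {ω | DeclaresH1 A B (fun t => X t ω)} -
        B * P.real {ω | DeclaresH0 A B (fun t => X t ω)})| ≤ c + 3 * D := by
  -- `V` is the threshold crossed, with its sign, and `S` is `L` at the exit time. Dominated
  -- convergence along the stopped process gives the exact identity for the mean of `S`; then `S`
  -- and `V` are compared pointwise.
  set V : Ω → ℝ := fun ω => {ω | DeclaresH1 A B (fun t => X t ω)}.indicator (fun _ => A) ω -
    {ω | DeclaresH0 A B (fun t => X t ω)}.indicator (fun _ => B) ω with hV
  set S : Ω → ℝ := fun ω => L (exitTime A B (fun t => X t ω)).toNat ω with hS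
  have hlim : ∀ᵐ ω ∂P, Tendsto (fun n => stoppedLLR A B L X n ω) atTop (𝓝 (S ω)) := by
    filter_upwards [hL.ae_exitTime_ne_top hX hA hB] with ω hω
    obtain ⟨N, hN⟩ := ENat.ne_top_iff_exists.1 hω
    refine tendsto_const_nhds.congr' ?_
    filter_upwards [eventually_ge_atTop N] with n hn
    obtain ⟨m, hmn, hm, hor, heq⟩ := stoppedLLR_eq (A := A) (B := B) (X := X) hL.zero n ω
    rw [heq, hS]
    simp only [← hN, ENat.toNat_natCast] at hm hor ⊢
    rw [Nat.cast_le] at hm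
    rcases hor with rfl | h
    · rw [le_antisymm hm hn]
    · rw [Nat.cast_inj.1 h]
  have hbdd := hL.ae_abs_stoppedLLR_le hX hA hB
  have hSmeas : AEStronglyMeasurable S P :=
    aestronglyMeasurable_of_tendsto_ae atTop
      (fun n => (hL.measurable_stoppedLLR hX n).aestronglyMeasurable) hlim
  have hSint : Integrable S P := by
    refine Integrable.of_bound hSmeas (A + B + c + D) ?_
    filter_upwards [hlim, hbdd] with ω h1 h2
    exact le_of_tendsto h1.norm (Eventually.of_forall h2)
  have hint : Tendsto (fun n => ∫ ω, stoppedLLR A B L X n ω ∂P) atTop (𝓝 (∫ ω, S ω ∂P)) :=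
    tendsto_integral_of_dominated_convergence (fun _ => A + B + c + D)
      (fun n => (hL.measurable_stoppedLLR hX n).aestronglyMeasurable) (integrable_const _)
      (fun n => by filter_upwards [hbdd] with ω hω using hω n) hlim
  have hwald : ∫ ω, S ω ∂P =
      μ * (∫⁻ ω, (exitTime A B (fun t => X t ω) : ℝ≥0∞) ∂P).toReal := by
    refine tendsto_nhds_unique hint ?_
    have hfin := hL.lintegral_exitTime_ne_top hX hA hB
    rw [hX.lintegral_exitTime] at hfin ⊢
    simp only [hL.integral_stoppedLLR hX]
    rw [ENNReal.tsum_toReal_eq (ENNReal.ne_top_of_tsum_ne_top hfin)]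
    exact (ENNReal.hasSum_toReal hfin).tendsto_sum_nat.const_mul μ
  have hVint1 : Integrable (fun ω => {ω | DeclaresH1 A B (fun t => X t ω)}.indicator
      (fun _ => A) ω) P := (integrable_const A).indicator hX.measurableSet_declaresH1
  have hVint0 : Integrable (fun ω => {ω | DeclaresH0 A B (fun t => X t ω)}.indicator
      (fun _ => B) ω) P := (integrable_const B).indicator hX.measurableSet_declaresH0
  have hVeq : ∫ ω, V ω ∂P = A * P.real {ω | DeclaresH1 A B (fun t => X t ω)} -
      B * P.real {ω | DeclaresH0 A B (fun t => X t ω)} := by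
    rw [hV, integral_sub hVint1 hVint0, integral_indicator_const _ hX.measurableSet_declaresH1,
      integral_indicator_const _ hX.measurableSet_declaresH0, smul_eq_mul, smul_eq_mul, mul_comm A,
      mul_comm B]
  rw [← hwald, ← hVeq, ← integral_sub hSint (show Integrable V P from hVint1.sub hVint0)]
  have hclose : ∀ᵐ ω ∂P, ‖S ω - V ω‖ ≤ c + 3 * D := by
    filter_upwards [hL.ae_exitTime_ne_top hX hA hB,
      hL.ae_abs_sub_le_of_exit_above (B := B) hX hA,
      hL.ae_abs_add_le_of_exit_below (A := A) hX hB] with ω hω h1 h0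
    obtain ⟨N, hN⟩ := ENat.ne_top_iff_exists.1 hω
    have hN' := (exitTime_eq_coe_iff.1 hN.symm).2
    have hSN : S ω = L N ω := by simp only [hS, ← hN, ENat.toNat_natCast]
    rcases declaresH1_or_declaresH0 hω with h | h
    · have hn : ¬ DeclaresH0 A B (fun t => X t ω) := fun h' =>
        not_declaresH1_and_declaresH0 hA hB ⟨h, h'⟩
      have hV' : V ω = A := by simp [hV, Set.indicator, h, hn]
      rw [hSN, hV']
      have h2 := h.2
      rw [← hN, ENat.toNat_natCast] at h2
      exact h1 N hN' h2
    · have hn : ¬ DeclaresH1 A B (fun t => X t ω) := fun h' =>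
        not_declaresH1_and_declaresH0 hA hB ⟨h', h⟩
      have hV' : V ω = -B := by simp [hV, Set.indicator, h, hn]
      rw [hSN, hV', sub_neg_eq_add]
      have h2 := h.2
      rw [← hN, ENat.toNat_natCast] at h2
      exact h0 N hN' h2
  have := norm_integral_le_of_norm_le_const hclose
  rwa [probReal_univ, mul_one] at this

end Model

end LevelTriggered

namespace LevelTriggered

open Filter Topology

/-! ### The log-likelihood ratio of one observation -/

section SingleObservation

variable {𝓨 : Type*} [MeasurableSpace 𝓨] {ν : Measure 𝓨} {g₀ g₁ : 𝓨 → ℝ}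

theorem measurable_log_div (h₀ : Measurable g₀) (h₁ : Measurable g₁) :
    Measurable fun x => Real.log (g₁ x / g₀ x) :=
  Real.measurable_log.comp (h₁.div h₀)

theorem measurable_exp_neg_log_div (h₀ : Measurable g₀) (h₁ : Measurable g₁) :
    Measurable fun x => Real.exp (-Real.log (g₁ x / g₀ x)) :=
  (measurable_log_div h₀ h₁).neg.exp

/-- Almost everywhere the densities vanish together, so the default values of division and
`Real.log` at zero carry no mass. -/
theorem withDensity_eq_withDensity_exp_neg_log (h₀ : Measurable g₀) (h₁ : Measurable g₁)
    (hn₀ : ∀ x, 0 ≤ g₀ x) (hn₁ : ∀ x, 0 ≤ g₁ x) (hsupp : ∀ᵐ x ∂ν, g₀ x = 0 ↔ g₁ x = 0) :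
    ν.withDensity (fun x => ENNReal.ofReal (g₀ x)) =
      (ν.withDensity fun x => ENNReal.ofReal (g₁ x)).withDensity
        fun x => ENNReal.ofReal (Real.exp (-Real.log (g₁ x / g₀ x))) := by
  rw [← withDensity_mul _ h₁.ennreal_ofReal
    (measurable_exp_neg_log_div h₀ h₁).ennreal_ofReal]
  refine withDensity_congr_ae ?_
  filter_upwards [hsupp] with x hx
  rw [Pi.mul_apply, ← ENNReal.ofReal_mul (hn₁ x)]
  congr 1
  by_cases h : g₀ x = 0
  · rw [h, hx.1 h, zero_mul]
  · have hp₀ : 0 < g₀ x := lt_of_le_of_ne (hn₀ x) (Ne.symm h)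
    have hp₁ : 0 < g₁ x := lt_of_le_of_ne (hn₁ x) fun h' => h (hx.2 h'.symm)
    rw [← Real.log_inv, inv_div, Real.exp_log (div_pos hp₀ hp₁)]
    field_simp

variable {φ : ℝ}

/-- The likelihood ratio `exp (-log (g₁ / g₀))` has mean 1 under `g₁`. This writes the
Kullback–Leibler divergence as the integral of the nonnegative function `exp (-x) - (1 - x)` of the
log ratio `x`. -/
theorem integral_exp_neg_log_sub_eq (h₀ : Measurable g₀) (h₁ : Measurable g₁)
    (hn₀ : ∀ x, 0 ≤ g₀ x) (hn₁ : ∀ x, 0 ≤ g₁ x) (hsupp : ∀ᵐ x ∂ν, g₀ x = 0 ↔ g₁ x = 0)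
    [IsProbabilityMeasure (ν.withDensity fun x => ENNReal.ofReal (g₀ x))]
    [IsProbabilityMeasure (ν.withDensity fun x => ENNReal.ofReal (g₁ x))]
    (hφ : ∀ᵐ x ∂(ν.withDensity fun x => ENNReal.ofReal (g₁ x)),
      |Real.log (g₁ x / g₀ x)| ≤ φ) :
    Integrable (fun x => Real.exp (-Real.log (g₁ x / g₀ x)) - (1 - Real.log (g₁ x / g₀ x)))
        (ν.withDensity fun x => ENNReal.ofReal (g₁ x)) ∧
      ∫ x, (Real.exp (-Real.log (g₁ x / g₀ x)) - (1 - Real.log (g₁ x / g₀ x)))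
          ∂(ν.withDensity fun x => ENNReal.ofReal (g₁ x)) =
        ∫ x, Real.log (g₁ x / g₀ x) ∂(ν.withDensity fun x => ENNReal.ofReal (g₁ x)) := by
  have hm := measurable_log_div h₀ h₁
  have hprob : IsProbabilityMeasure
      (ν.withDensity fun x => ENNReal.ofReal (g₀ x)) := inferInstance
  rw [withDensity_eq_withDensity_exp_neg_log h₀ h₁ hn₀ hn₁ hsupp] at hprob
  set ρ := ν.withDensity fun x => ENNReal.ofReal (g₁ x)
  have hlog : Integrable (fun x => Real.log (g₁ x / g₀ x)) ρ :=
    Integrable.of_bound hm.aestronglyMeasurable φ hφ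
  have hexp_one : ∫⁻ x, ENNReal.ofReal (Real.exp (-Real.log (g₁ x / g₀ x))) ∂ρ = 1 := by
    have := hprob.measure_univ
    rwa [withDensity_apply _ MeasurableSet.univ, Measure.restrict_univ] at this
  have hexp : Integrable (fun x => Real.exp (-Real.log (g₁ x / g₀ x))) ρ := by
    refine (lintegral_ofReal_ne_top_iff_integrable (measurable_exp_neg_log_div h₀ h₁).aestronglyMeasurable
      (Eventually.of_forall fun x => (Real.exp_pos _).le)).1 ?_
    rw [hexp_one]
    exact ENNReal.one_ne_top
  have hone : Integrable (fun x => 1 - Real.log (g₁ x / g₀ x)) ρ := (integrable_const 1).sub hlog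
  refine ⟨hexp.sub hone, ?_⟩
  rw [integral_sub hexp hone, integral_sub (integrable_const 1) hlog,
    integral_eq_lintegral_of_nonneg_ae (Eventually.of_forall fun x => (Real.exp_pos _).le)
      (measurable_exp_neg_log_div h₀ h₁).aestronglyMeasurable, hexp_one]
  simp

theorem exp_neg_sub_nonneg (x : ℝ) : 0 ≤ Real.exp (-x) - (1 - x) := by
  linarith [Real.add_one_le_exp (-x)]

theorem integral_log_div_nonneg (h₀ : Measurable g₀) (h₁ : Measurable g₁)
    (hn₀ : ∀ x, 0 ≤ g₀ x) (hn₁ : ∀ x, 0 ≤ g₁ x) (hsupp : ∀ᵐ x ∂ν, g₀ x = 0 ↔ g₁ x = 0)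
    [IsProbabilityMeasure (ν.withDensity fun x => ENNReal.ofReal (g₀ x))]
    [IsProbabilityMeasure (ν.withDensity fun x => ENNReal.ofReal (g₁ x))]
    (hφ : ∀ᵐ x ∂(ν.withDensity fun x => ENNReal.ofReal (g₁ x)),
      |Real.log (g₁ x / g₀ x)| ≤ φ) :
    0 ≤ ∫ x, Real.log (g₁ x / g₀ x) ∂(ν.withDensity fun x => ENNReal.ofReal (g₁ x)) := by
  rw [← (integral_exp_neg_log_sub_eq h₀ h₁ hn₀ hn₁ hsupp hφ).2]
  exact integral_nonneg fun x => exp_neg_sub_nonneg _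

/-- The function `exp (-x) - (1 - x)` vanishes only at `x = 0`, so zero divergence would force the
densities to agree a.e. -/
theorem integral_log_div_pos (h₀ : Measurable g₀) (h₁ : Measurable g₁)
    (hn₀ : ∀ x, 0 ≤ g₀ x) (hn₁ : ∀ x, 0 ≤ g₁ x) (hsupp : ∀ᵐ x ∂ν, g₀ x = 0 ↔ g₁ x = 0)
    [IsProbabilityMeasure (ν.withDensity fun x => ENNReal.ofReal (g₀ x))]
    [IsProbabilityMeasure (ν.withDensity fun x => ENNReal.ofReal (g₁ x))]
    (hφ : ∀ᵐ x ∂(ν.withDensity fun x => ENNReal.ofReal (g₁ x)),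
      |Real.log (g₁ x / g₀ x)| ≤ φ) (hne : ¬ g₀ =ᵐ[ν] g₁) :
    0 < ∫ x, Real.log (g₁ x / g₀ x) ∂(ν.withDensity fun x => ENNReal.ofReal (g₁ x)) := by
  obtain ⟨hint, heq⟩ := integral_exp_neg_log_sub_eq h₀ h₁ hn₀ hn₁ hsupp hφ
  refine (integral_log_div_nonneg h₀ h₁ hn₀ hn₁ hsupp hφ).lt_of_ne fun h => hne ?_
  rw [← heq, eq_comm, integral_eq_zero_iff_of_nonneg (fun x => exp_neg_sub_nonneg _) hint,
    EventuallyEq, ae_withDensity_iff h₁.ennreal_ofReal] at h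
  filter_upwards [h, hsupp] with x hx hs
  by_cases h0 : g₁ x = 0
  · rw [h0, hs.2 h0]
  · have hp₁ : 0 < g₁ x := lt_of_le_of_ne (hn₁ x) (Ne.symm h0)
    have hp₀ : 0 < g₀ x := lt_of_le_of_ne (hn₀ x) fun h' => h0 (hs.1 h'.symm)
    have hx' := hx (ENNReal.ofReal_pos.2 hp₁).ne'
    have hlog : Real.log (g₁ x / g₀ x) = 0 := by
      by_contra hlog
      have := Real.one_sub_lt_exp_neg hlog
      simp only [Pi.zero_apply] at hx'
      linarith
    have := Real.eq_one_of_pos_of_log_eq_zero (div_pos hp₁ hp₀) hlog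
    rw [div_eq_one_iff_eq hp₀.ne'] at this
    exact this.symm

end SingleObservation

/-! ### The global log-likelihood ratio -/

section Global

theorem localLLR_succ_sub {Ω 𝓨 : Type*} (g₀ g₁ : 𝓨 → ℝ) (y : ℕ → Ω → 𝓨) (n : ℕ) (ω : Ω) :
    localLLR g₀ g₁ y (n + 1) ω - localLLR g₀ g₁ y n ω = Real.log (g₁ (y n ω) / g₀ (y n ω)) := by
  rw [localLLR, localLLR, Finset.sum_range_succ, add_sub_cancel_left]

theorem sum_localLLR_eq {Ω : Type*} {K : ℕ} {𝓨 : Fin K → Type*} (g₀ g₁ : (k : Fin K) → 𝓨 k → ℝ)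
    (y : (k : Fin K) → ℕ → Ω → 𝓨 k) (n : ℕ) (ω : Ω) :
    ∑ k, localLLR (g₀ k) (g₁ k) (y k) n ω = ∑ p ∈ Finset.univ ×ˢ Finset.range n,
      Real.log (g₁ p.1 (y p.1 p.2 ω) / g₀ p.1 (y p.1 p.2 ω)) := by
  simp only [localLLR, Finset.sum_product]

variable {Ω : Type*} {mΩ : MeasurableSpace Ω} {K : ℕ} {𝓨 : Fin K → Type*}
  [m𝓨 : ∀ k, MeasurableSpace (𝓨 k)]

/-- The information that is contained in the first `n` observations of all sensors. -/
def observationFiltration (y : (k : Fin K) → ℕ → Ω → 𝓨 k) (hy : ∀ k s, Measurable (y k s)) :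
    Filtration ℕ mΩ where
  seq n := ⨆ p ∈ {p : Fin K × ℕ | p.2 < n}, (m𝓨 p.1).comap (y p.1 p.2)
  mono' _ _ hmn := biSup_mono fun _ hp => lt_of_lt_of_le hp hmn
  le' _ := iSup₂_le fun p _ => (hy p.1 p.2).comap_le

variable {ν : (k : Fin K) → Measure (𝓨 k)} {g₀ g₁ : (k : Fin K) → 𝓨 k → ℝ}
  {P Q : Measure Ω} {y : (k : Fin K) → ℕ → Ω → 𝓨 k}

theorem measurable_observation (hy : ∀ k s, Measurable (y k s)) (k : Fin K) {s n : ℕ}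
    (hs : s < n) : Measurable[observationFiltration y hy n] (y k s) := by
  rw [measurable_iff_comap_le]
  exact le_iSup₂_of_le (f := fun (p : Fin K × ℕ) (_ : p ∈ {p : Fin K × ℕ | p.2 < n}) =>
    (m𝓨 p.1).comap (y p.1 p.2)) (k, s) hs le_rfl

theorem measurable_localLLR (hy : ∀ k s, Measurable (y k s)) (h₀ : ∀ k, Measurable (g₀ k))
    (h₁ : ∀ k, Measurable (g₁ k)) (k : Fin K) (n : ℕ) :
    Measurable[observationFiltration y hy n] (localLLR (g₀ k) (g₁ k) (y k) n) := by
  unfold localLLR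
  exact Finset.measurable_sum _ fun s hs => (measurable_log_div (h₀ k) (h₁ k)).comp
    (measurable_observation hy k (Finset.mem_range.1 hs))

/-- On a cylinder set the integrand is a product of functions of independent observations, so both
sides factor and the one-observation change of measure applies to each factor. -/
theorem measure_iInter_eq_setLIntegral
    (hy : ∀ k s, Measurable (y k s)) (h₀ : ∀ k, Measurable (g₀ k)) (h₁ : ∀ k, Measurable (g₁ k))
    (hn₀ : ∀ k x, 0 ≤ g₀ k x) (hn₁ : ∀ k x, 0 ≤ g₁ k x)
    (hsupp : ∀ k, ∀ᵐ x ∂(ν k), g₀ k x = 0 ↔ g₁ k x = 0)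
    (hP : iIndepFun (fun p : Fin K × ℕ => y p.1 p.2) P)
    (hQ : iIndepFun (fun p : Fin K × ℕ => y p.1 p.2) Q)
    (hlawP : ∀ k s, P.map (y k s) = (ν k).withDensity fun x => ENNReal.ofReal (g₁ k x))
    (hlawQ : ∀ k s, Q.map (y k s) = (ν k).withDensity fun x => ENNReal.ofReal (g₀ k x))
    (n : ℕ) (A : (p : Fin K × ℕ) → Set (𝓨 p.1)) (hA : ∀ p, MeasurableSet (A p)) :
    Q (⋂ p ∈ Finset.univ ×ˢ Finset.range n, y p.1 p.2 ⁻¹' A p) =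
      ∫⁻ ω in ⋂ p ∈ Finset.univ ×ˢ Finset.range n, y p.1 p.2 ⁻¹' A p,
        ENNReal.ofReal (Real.exp (-∑ k, localLLR (g₀ k) (g₁ k) (y k) n ω)) ∂P := by
  classical
  set e : (p : Fin K × ℕ) → 𝓨 p.1 → ℝ≥0∞ := fun p => (A p).indicator
    fun x => ENNReal.ofReal (Real.exp (-Real.log (g₁ p.1 x / g₀ p.1 x))) with he
  have hem p : Measurable (e p) :=
    (measurable_exp_neg_log_div (h₀ p.1) (h₁ p.1)).ennreal_ofReal.indicator (hA p)
  have hmeas : MeasurableSet (⋂ p ∈ Finset.univ ×ˢ Finset.range n, y p.1 p.2 ⁻¹' A p) :=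
    Finset.measurableSet_biInter _ fun p _ => hy _ _ (hA p)
  have hprod ω : (⋂ p ∈ Finset.univ ×ˢ Finset.range n, y p.1 p.2 ⁻¹' A p).indicator
      (fun ω => ENNReal.ofReal (Real.exp (-∑ k, localLLR (g₀ k) (g₁ k) (y k) n ω))) ω =
        ∏ p ∈ Finset.univ ×ˢ Finset.range n, (e p ∘ y p.1 p.2) ω := by
    by_cases hω : ω ∈ ⋂ p ∈ Finset.univ ×ˢ Finset.range n, y p.1 p.2 ⁻¹' A p
    · rw [Set.indicator_of_mem hω, sum_localLLR_eq, ← Finset.sum_neg_distrib, Real.exp_sum,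
        ENNReal.ofReal_prod_of_nonneg fun _ _ => (Real.exp_pos _).le]
      refine Finset.prod_congr rfl fun p hp => ?_
      have hmem : y p.1 p.2 ω ∈ A p := Set.mem_iInter₂.1 hω p hp
      simp only [he, Function.comp_apply, Set.indicator, if_pos hmem]
    · rw [Set.indicator_of_notMem hω]
      simp only [Set.mem_iInter, not_forall] at hω
      obtain ⟨p, hp, hpA⟩ := hω
      refine (Finset.prod_eq_zero hp ?_).symm
      have hmem : y p.1 p.2 ω ∉ A p := hpA
      simp only [he, Function.comp_apply, Set.indicator, if_neg hmem]
  rw [← lintegral_indicator hmeas, lintegral_congr hprod,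
    lintegral_prod_eq_prod_lintegral_of_indepFun _ (fun p => e p ∘ y p.1 p.2)
      (hP.comp e hem) fun p => (hem p).comp (hy _ _),
    hQ.meas_biInter fun p _ => ⟨A p, hA p, rfl⟩]
  refine Finset.prod_congr rfl fun p _ => ?_
  rw [← Measure.map_apply (hy _ _) (hA p), hlawQ,
    withDensity_eq_withDensity_exp_neg_log (h₀ _) (h₁ _) (hn₀ _) (hn₁ _) (hsupp _),
    withDensity_apply _ (hA p), ← lintegral_indicator (hA p), ← hlawP p.1 p.2,
    lintegral_map (hem p) (hy _ _)]
  rfl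

/-- Cylinder sets form a π-system generating the σ-algebra at time `n`, so agreement there extends
to all its events. -/
theorem measure_eq_setLIntegral_exp_neg [IsFiniteMeasure Q]
    (hy : ∀ k s, Measurable (y k s)) (h₀ : ∀ k, Measurable (g₀ k)) (h₁ : ∀ k, Measurable (g₁ k))
    (hn₀ : ∀ k x, 0 ≤ g₀ k x) (hn₁ : ∀ k x, 0 ≤ g₁ k x)
    (hsupp : ∀ k, ∀ᵐ x ∂(ν k), g₀ k x = 0 ↔ g₁ k x = 0)
    (hP : iIndepFun (fun p : Fin K × ℕ => y p.1 p.2) P)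
    (hQ : iIndepFun (fun p : Fin K × ℕ => y p.1 p.2) Q)
    (hlawP : ∀ k s, P.map (y k s) = (ν k).withDensity fun x => ENNReal.ofReal (g₁ k x))
    (hlawQ : ∀ k s, Q.map (y k s) = (ν k).withDensity fun x => ENNReal.ofReal (g₀ k x))
    (n : ℕ) {E : Set Ω} (hE : MeasurableSet[observationFiltration y hy n] E) :
    Q E = ∫⁻ ω in E,
      ENNReal.ofReal (Real.exp (-∑ k, localLLR (g₀ k) (g₁ k) (y k) n ω)) ∂P := by
  classical
  set C := piiUnionInter (fun p : Fin K × ℕ => {s | MeasurableSet[(m𝓨 p.1).comap (y p.1 p.2)] s})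
    {p : Fin K × ℕ | p.2 < n} with hC
  have hgen : (observationFiltration y hy n : MeasurableSpace Ω) =
      MeasurableSpace.generateFrom C :=
    (generateFrom_piiUnionInter_measurableSet _ _).symm
  have hpi : IsPiSystem C :=
    isPiSystem_piiUnionInter _ (fun p : Fin K × ℕ => @MeasurableSpace.isPiSystem_measurableSet Ω
      ((m𝓨 p.1).comap (y p.1 p.2))) _
  have hle := (observationFiltration y hy).le n
  set R := P.withDensity fun ω =>
    ENNReal.ofReal (Real.exp (-∑ k, localLLR (g₀ k) (g₁ k) (y k) n ω)) with hR
  have hCeq : ∀ s ∈ C, Q.trim hle s = R.trim hle s := by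
    intro s hs
    have hsm : MeasurableSet[observationFiltration y hy n] s := by
      rw [hgen]
      exact MeasurableSpace.measurableSet_generateFrom hs
    rw [trim_measurableSet_eq hle hsm, trim_measurableSet_eq hle hsm, hR,
      withDensity_apply _ (hle s hsm)]
    obtain ⟨t, ht, f, hf, rfl⟩ := hs
    have hA : ∀ p : Fin K × ℕ, ∃ A : Set (𝓨 p.1), MeasurableSet A ∧
        y p.1 p.2 ⁻¹' A = if p ∈ t then f p else Set.univ := by
      intro p
      by_cases hp : p ∈ t
      · obtain ⟨A, hA, hAf⟩ := hf p hp
        exact ⟨A, hA, by rw [if_pos hp, hAf]⟩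
      · exact ⟨Set.univ, MeasurableSet.univ, by rw [if_neg hp, Set.preimage_univ]⟩
    choose A hAm hAf using hA
    have heq : ⋂ p ∈ t, f p = ⋂ p ∈ Finset.univ ×ˢ Finset.range n, y p.1 p.2 ⁻¹' A p := by
      ext ω
      simp only [hAf, Set.mem_iInter, Finset.mem_product, Finset.mem_univ, true_and,
        Finset.mem_range]
      constructor
      · intro h p _
        by_cases hp : p ∈ t
        · rw [if_pos hp]
          exact h p hp
        · rw [if_neg hp]
          trivial
      · intro h p hp
        have := h p (ht hp)
        rwa [if_pos hp] at this
    rw [heq]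
    exact measure_iInter_eq_setLIntegral hy h₀ h₁ hn₀ hn₁ hsupp hP hQ hlawP hlawQ n A hAm
  have huniv : Set.univ ∈ C := ⟨∅, by simp, fun _ => Set.univ, by simp, by simp⟩
  have hext : Q.trim hle = R.trim hle :=
    ext_of_generate_finite C hgen hpi hCeq (hCeq _ huniv)
  rw [← withDensity_apply _ (hle E hE), ← hR, ← trim_measurableSet_eq hle hE,
    ← trim_measurableSet_eq hle hE, hext]

/-- Observation number `n + 1`, indexed by `n`, is independent of the first `n`, so the integral
over a past event factors. -/
theorem setIntegral_step_eq [IsProbabilityMeasure P] {φ : ℝ}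
    (hy : ∀ k s, Measurable (y k s)) (h₀ : ∀ k, Measurable (g₀ k)) (h₁ : ∀ k, Measurable (g₁ k))
    (hP : iIndepFun (fun p : Fin K × ℕ => y p.1 p.2) P)
    (hlawP : ∀ k s, P.map (y k s) = (ν k).withDensity fun x => ENNReal.ofReal (g₁ k x))
    (hφ : ∀ k s, ∀ᵐ ω ∂P, |Real.log (g₁ k (y k s ω) / g₀ k (y k s ω))| ≤ φ)
    (n : ℕ) {E : Set Ω} (hE : MeasurableSet[observationFiltration y hy n] E) :
    ∫ ω in E, ∑ k, Real.log (g₁ k (y k n ω) / g₀ k (y k n ω)) ∂P =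
      (∑ k, ∫ x, Real.log (g₁ k x / g₀ k x)
        ∂((ν k).withDensity fun x => ENNReal.ofReal (g₁ k x))) * P.real E := by
  have hm k := measurable_log_div (h₀ k) (h₁ k)
  have hint k : Integrable (fun ω => Real.log (g₁ k (y k n ω) / g₀ k (y k n ω))) P :=
    Integrable.of_bound ((hm k).comp (hy k n)).aestronglyMeasurable φ (hφ k n)
  rw [integral_finsetSum _ fun k _ => (hint k).integrableOn, Finset.sum_mul]
  refine Finset.sum_congr rfl fun k _ => ?_
  have hindep : Indep (observationFiltration y hy n : MeasurableSpace Ω)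
      ((m𝓨 k).comap (y k n)) P := by
    have h := indep_iSup_of_disjoint (fun p : Fin K × ℕ => (hy p.1 p.2).comap_le) hP.iIndep
      (S := {p | p.2 < n}) (T := {(k, n)})
      (Set.disjoint_singleton_right.2 (by simp))
    rwa [iSup_singleton] at h
  rw [hindep.setIntegral_eq_mul ((observationFiltration y hy).le n)
    (f := fun x => Real.log (g₁ k x / g₀ k x)) (hy k n).aemeasurable hE
    (hm k).aestronglyMeasurable, ← hlawP k n,
    integral_map (hy k n).aemeasurable (hm k).aestronglyMeasurable, mul_comm]

theorem isLLRProcess_sum_localLLR [IsProbabilityMeasure P] [IsProbabilityMeasure Q] {φ : ℝ}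
    (hy : ∀ k s, Measurable (y k s)) (h₀ : ∀ k, Measurable (g₀ k)) (h₁ : ∀ k, Measurable (g₁ k))
    (hn₀ : ∀ k x, 0 ≤ g₀ k x) (hn₁ : ∀ k x, 0 ≤ g₁ k x)
    (hsupp : ∀ k, ∀ᵐ x ∂(ν k), g₀ k x = 0 ↔ g₁ k x = 0)
    (hne : ∃ k, ¬ g₀ k =ᵐ[ν k] g₁ k)
    (hP : iIndepFun (fun p : Fin K × ℕ => y p.1 p.2) P)
    (hQ : iIndepFun (fun p : Fin K × ℕ => y p.1 p.2) Q)
    (hlawP : ∀ k s, P.map (y k s) = (ν k).withDensity fun x => ENNReal.ofReal (g₁ k x))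
    (hlawQ : ∀ k s, Q.map (y k s) = (ν k).withDensity fun x => ENNReal.ofReal (g₀ k x))
    (hφ : ∀ k s, ∀ᵐ ω ∂P, |Real.log (g₁ k (y k s ω) / g₀ k (y k s ω))| ≤ φ) :
    IsLLRProcess P Q (observationFiltration y hy)
      (fun n ω => ∑ k, localLLR (g₀ k) (g₁ k) (y k) n ω) (K * φ)
      (∑ k, ∫ x, Real.log (g₁ k x / g₀ k x)
        ∂((ν k).withDensity fun x => ENNReal.ofReal (g₁ k x))) where
  zero ω := by simp [localLLR]
  adapted n := Finset.measurable_sum _ fun k _ => measurable_localLLR hy h₀ h₁ k n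
  abs_step_le n := by
    filter_upwards [ae_all_iff.2 fun k => hφ k n] with ω hω
    rw [← Finset.sum_sub_distrib]
    simp only [localLLR_succ_sub]
    refine (Finset.abs_sum_le_sum_abs _ _).trans ((Finset.sum_le_sum fun k _ => hω k).trans ?_)
    simp
  drift_pos := by
    have i₀ k : IsProbabilityMeasure ((ν k).withDensity fun x => ENNReal.ofReal (g₀ k x)) :=
      hlawQ k 0 ▸ Measure.isProbabilityMeasure_map (hy k 0).aemeasurable
    have i₁ k : IsProbabilityMeasure ((ν k).withDensity fun x => ENNReal.ofReal (g₁ k x)) :=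
      hlawP k 0 ▸ Measure.isProbabilityMeasure_map (hy k 0).aemeasurable
    have hφ' k : ∀ᵐ x ∂((ν k).withDensity fun x => ENNReal.ofReal (g₁ k x)),
        |Real.log (g₁ k x / g₀ k x)| ≤ φ := by
      rw [← hlawP k 0]
      refine (ae_map_iff (hy k 0).aemeasurable ?_).2 (hφ k 0)
      exact measurableSet_le (measurable_log_div (h₀ k) (h₁ k)).abs measurable_const
    obtain ⟨k, hk⟩ := hne
    exact Finset.sum_pos' (fun k _ => integral_log_div_nonneg (h₀ k) (h₁ k) (hn₀ k) (hn₁ k)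
        (hsupp k) (hφ' k))
      ⟨k, Finset.mem_univ k, integral_log_div_pos (h₀ k) (h₁ k) (hn₀ k) (hn₁ k) (hsupp k)
        (hφ' k) hk⟩
  setIntegral_step n E hE := by
    simp only [← Finset.sum_sub_distrib, localLLR_succ_sub]
    exact setIntegral_step_eq hy h₀ h₁ hP hlawP hφ n hE
  density n E hE := measure_eq_setLIntegral_exp_neg hy h₀ h₁ hn₀ hn₁ hsupp hP hQ hlawP hlawQ n hE

end Global

end LevelTriggered

namespace LevelTriggered

/-! ### Performance bounds for tests with nearly exact likelihood ratio statistics -/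

/-- Wald's relations, up to an error `R`, between the upper and lower thresholds `A`, `B`, the two
error probabilities `a`, `b`, and the mean delay `e` under the hypothesis with drift `μ` and error
probability `b`. -/
structure WaldBounds (μ R A B a b e : ℝ) : Prop where
  left_nonneg : 0 ≤ a
  right_nonneg : 0 ≤ b
  wald : |μ * e - (A * (1 - b) - B * b)| ≤ R
  le_left : Real.exp (-A - R) * (1 - b) ≤ a
  left_le : a ≤ Real.exp (-A + R) * (1 - b)

namespace WaldBounds

variable {μ R A B A' B' a b e e' : ℝ}

/-- Both tests have the same `a` and `b`, so the factor `1 - b` cancels between the lower bound for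
one and the upper bound for the other. -/
theorem threshold_sub_le (h : WaldBounds μ R A B a b e) (h' : WaldBounds μ R A' B' a b e')
    (hb : b < 1) : A' - A ≤ 2 * R := by
  have h1 := le_of_mul_le_mul_right (h.le_left.trans h'.left_le) (sub_pos.2 hb)
  rw [Real.exp_le_exp] at h1
  linarith

theorem abs_threshold_sub_le (h : WaldBounds μ R A B a b e) (h' : WaldBounds μ R A' B' a b e')
    (hb : b < 1) : |A' - A| ≤ 2 * R := by
  have h1 := h.threshold_sub_le h' hb
  have h2 := h'.threshold_sub_le h hb
  exact abs_le.2 ⟨by linarith, h1⟩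

/-- The two Wald errors contribute `2 * R`, and the threshold differences, weighted by `1 - b` and
`b`, another `2 * R`. The bound on `B' - B` comes from the other hypothesis. -/
theorem abs_delay_sub_le (h : WaldBounds μ R A B a b e) (h' : WaldBounds μ R A' B' a b e')
    (hμ : 0 < μ) (hb : b < 1) (hB : |B' - B| ≤ 2 * R) : |e' - e| ≤ 4 * R / μ := by
  have hA := abs_le.1 (h.abs_threshold_sub_le h' hb)
  have hB := abs_le.1 hB
  have hw := abs_le.1 h.wald
  have hw' := abs_le.1 h'.wald
  have hb0 := h.right_nonneg
  have hb1 : 0 ≤ 1 - b := by linarith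
  have h1 := mul_le_mul_of_nonneg_right hA.1 hb1
  have h2 := mul_le_mul_of_nonneg_right hA.2 hb1
  have h3 := mul_le_mul_of_nonneg_right hB.1 hb0
  have h4 := mul_le_mul_of_nonneg_right hB.2 hb0
  rw [le_div_iff₀ hμ, ← abs_of_pos hμ, ← abs_mul, abs_le]
  constructor <;> linarith

theorem drift_mul_le (h : WaldBounds μ R A B a b e) (hA : 0 < A) (hB : 0 < B) :
    μ * e ≤ A + R := by
  have h1 := (abs_le.1 h.wald).2
  have h2 := mul_nonneg hA.le h.right_nonneg
  have h3 := mul_nonneg hB.le h.right_nonneg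
  linarith

/-- The false alarm constraint forces `A` up to `-log α` minus a constant. The term `B * b` is
harmless because `b` decays like `exp (-B)`; this is the purpose of `hdual`. -/
theorem le_drift_mul {β M α : ℝ} (h : WaldBounds μ R A B a b e)
    (hdual : b ≤ Real.exp (-B + R) * (1 - a)) (hA : 0 < A) (hα : 0 < α)
    (hα1 : α < 1 / 2) (hβ1 : β < 1 / 2) (haα : a ≤ α) (hbβ : b ≤ β)
    (hM : β * |Real.log α| ≤ M) :
    -Real.log α - M - Real.log 2 - |R| - Real.exp R - R ≤ μ * e := by
  have ha := h.left_nonneg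
  have hb := h.right_nonneg
  have hBb : B * b ≤ Real.exp R := by
    have h1 : B ≤ Real.exp B := by linarith [Real.add_one_le_exp B]
    have h2 : b ≤ Real.exp (-B + R) := hdual.trans
      (mul_le_of_le_one_right (Real.exp_pos _).le (by linarith))
    calc B * b ≤ Real.exp B * Real.exp (-B + R) := by gcongr
      _ = Real.exp R := by rw [← Real.exp_add]; ring_nf
  have hAlow : -Real.log α - R - Real.log 2 ≤ A := by
    have h1 : Real.exp (-A - R) * (1 / 2) ≤ α :=
      (mul_le_mul_of_nonneg_left (by linarith) (Real.exp_pos _).le).trans (h.le_left.trans haα)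
    have h2 := Real.log_le_log (by positivity) h1
    rw [Real.log_mul (Real.exp_pos _).ne' (by norm_num), Real.log_exp, one_div, Real.log_inv] at h2
    linarith
  have hβ0 : 0 ≤ β := hb.trans hbβ
  have hlog : Real.log α ≤ 0 := Real.log_nonpos hα.le (by linarith)
  rw [abs_of_nonpos hlog] at hM
  have hlog2 : 0 ≤ Real.log 2 := Real.log_nonneg (by norm_num)
  -- With `|R|` in place of `R`, the product of `β` with the constants has a known sign and can be
  -- dropped.
  have h1 : (1 - β) * (-Real.log α - |R| - Real.log 2) ≤ (1 - β) * A :=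
    mul_le_mul_of_nonneg_left (by linarith [le_abs_self R]) (by linarith)
  have h2 : (1 - β) * A ≤ (1 - b) * A := by gcongr
  have h3 : 0 ≤ β * (|R| + Real.log 2) := by positivity
  have h4 := (abs_le.1 h.wald).1
  linarith

end WaldBounds

/-! ### Wald's relations for approximate LLR statistics under both hypotheses -/

section Assembly

variable {Ω : Type*} {mΩ : MeasurableSpace Ω} {P Q : Measure Ω} {F : Filtration ℕ mΩ}
  {L X : ℕ → Ω → ℝ} {c μ D A B : ℝ}

theorem IsLLRProcess.waldBounds [IsProbabilityMeasure P] [IsFiniteMeasure Q]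
    (hL : IsLLRProcess P Q F L c μ) (hX : IsApproximation P F L X D) (hA : 0 < A) (hB : 0 < B) :
    WaldBounds μ (c + 3 * D) A B (Q.real {ω | DeclaresH1 A B (fun t => X t ω)})
      (P.real {ω | DeclaresH0 A B (fun t => X t ω)})
      (∫⁻ ω, (exitTime A B (fun t => X t ω) : ℝ≥0∞) ∂P).toReal := by
  have hsum := hL.real_declares_add hX hA hB
  have hone : 1 - P.real {ω | DeclaresH0 A B (fun t => X t ω)} =
      P.real {ω | DeclaresH1 A B (fun t => X t ω)} := by linarith
  obtain ⟨h1, h2⟩ := hL.measure_declaresH1_bounds (B := B) hX hA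
  refine ⟨measureReal_nonneg, measureReal_nonneg, ?_, ?_, ?_⟩
  · rw [hone]
    exact hL.abs_drift_mul_meanDelay_sub_le hX hA hB
  · rw [hone, measureReal_def, measureReal_def,
      ← ENNReal.toReal_ofReal (Real.exp_pos (-A - _)).le, ← ENNReal.toReal_mul]
    exact ENNReal.toReal_mono (measure_ne_top _ _) h1
  · rw [hone, measureReal_def, measureReal_def,
      ← ENNReal.toReal_ofReal (Real.exp_pos (-A + _)).le, ← ENNReal.toReal_mul]
    exact ENNReal.toReal_mono (ENNReal.mul_ne_top ENNReal.ofReal_ne_top (measure_ne_top _ _)) h2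

/-- The performance bounds under both hypotheses. -/
theorem waldBounds_of_isLLRProcess {P : Fin 2 → Measure Ω} [∀ i, IsProbabilityMeasure (P i)]
    {μ₀ μ₁ : ℝ} (hL₁ : IsLLRProcess (P 1) (P 0) F L c μ₁)
    (hL₀ : IsLLRProcess (P 0) (P 1) F (fun n ω => -L n ω) c μ₀)
    (hX : ∀ i, IsApproximation (P i) F L X D) (hA : 0 < A) (hB : 0 < B) :
    WaldBounds μ₁ (c + 3 * D) A B (falseAlarm P X A B) (missedDetection P X A B)
        (meanDelay P X A B 1).toReal ∧
      WaldBounds μ₀ (c + 3 * D) B A (missedDetection P X A B) (falseAlarm P X A B)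
        (meanDelay P X A B 0).toReal := by
  refine ⟨hL₁.waldBounds (hX 1) hA hB, ?_⟩
  have h := hL₀.waldBounds (hX 0).neg hB hA
  simp only [declaresH0_neg, declaresH1_neg, exitTime_neg] at h
  exact h

theorem meanDelay_ne_top_of_isLLRProcess {P : Fin 2 → Measure Ω}
    [∀ i, IsProbabilityMeasure (P i)] {μ₀ μ₁ : ℝ} (hL₁ : IsLLRProcess (P 1) (P 0) F L c μ₁)
    (hL₀ : IsLLRProcess (P 0) (P 1) F (fun n ω => -L n ω) c μ₀)
    (hX : ∀ i, IsApproximation (P i) F L X D) (hA : 0 < A) (hB : 0 < B) (i : Fin 2) :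
    meanDelay P X A B i ≠ ⊤ := by
  match i with
  | 0 =>
    have h := hL₀.lintegral_exitTime_ne_top (hX 0).neg hB hA
    simp only [exitTime_neg] at h
    exact h
  | 1 => exact hL₁.lintegral_exitTime_ne_top (hX 1) hA hB

end Assembly

/-! ### The two detectors as approximations of the global LLR -/

section Detector

variable {Ω : Type*} {mΩ : MeasurableSpace Ω} {K : ℕ} {𝓨 : Fin K → Type*}
  [∀ k, MeasurableSpace (𝓨 k)] {ν : (k : Fin K) → Measure (𝓨 k)}
  {f : Fin 2 → (k : Fin K) → 𝓨 k → ℝ} {y : (k : Fin K) → ℕ → Ω → 𝓨 k} {Δ θ r : ℝ}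
  {d : Fin K → ℝ} {P : Measure Ω}

/-- Bounded overshoots bound the log-likelihood ratio of every single observation. -/
theorem ae_abs_log_div_le_of_overshoot_le (hf : ∀ i k, Measurable (f i k))
    (hy : ∀ k s, Measurable (y k s)) (hθ : 0 ≤ θ) (k : Fin K) {ρ : Measure (𝓨 k)}
    (hlaw : ∀ s, P.map (y k s) = ρ)
    (h_over : ∀ᵐ ω ∂P, samplingTime Δ (fun t => localLLR (f 0 k) (f 1 k) (y k) t ω) 1 ≠ ⊤ →
      overshoot Δ (fun t => localLLR (f 0 k) (f 1 k) (y k) t ω) 0 ≤ θ) (s : ℕ) :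
    ∀ᵐ ω ∂P, |Real.log (f 1 k (y k s ω) / f 0 k (y k s ω))| ≤ Δ + θ := by
  have hset : MeasurableSet {x | |Real.log (f 1 k x / f 0 k x)| ≤ Δ + θ} :=
    measurableSet_le (measurable_log_div (hf 0 k) (hf 1 k)).abs measurable_const
  -- The overshoot of the first sample controls only the first observation; equality of laws
  -- transfers the bound to all of them.
  rw [← ae_map_iff (hy k s).aemeasurable hset, hlaw s, ← hlaw 0,
    ae_map_iff (hy k 0).aemeasurable hset]
  filter_upwards [h_over] with ω hω
  have h := abs_apply_one_le_of_overshoot_le (by simp [localLLR]) hθ hω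
  simpa [localLLR] using h

theorem isApproximation_fusionLLR (hf : ∀ i k, Measurable (f i k))
    (hy : ∀ k s, Measurable (y k s)) (hΔ : 0 < Δ) (hθ : θ < r) (hr : 0 < r)
    (hd : ∀ k, 0 ≤ d k)
    (hstep : ∀ k s, ∀ᵐ ω ∂P, |Real.log (f 1 k (y k s ω) / f 0 k (y k s ω))| ≤ Δ + θ)
    (h_over : ∀ k n, ∀ᵐ ω ∂P,
      samplingTime Δ (fun t => localLLR (f 0 k) (f 1 k) (y k) t ω) (n + 1) ≠ ⊤ →
        overshoot Δ (fun t => localLLR (f 0 k) (f 1 k) (y k) t ω) n ≤ θ) :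
    IsApproximation P (observationFiltration y hy) (centralLLR f y) (fusionLLR f y Δ r d)
      (∑ k, (Δ + (⌈d k⌉₊ + 1 : ℕ) * (Δ + θ))) where
  zero ω := by simp [fusionLLR, fusionLocalLLR]
  adapted n := Finset.measurable_sum _ fun k _ =>
    @measurable_fusionLocalLLR Ω (localLLR (f 0 k) (f 1 k) (y k)) Δ r (d k) n
      (observationFiltration y hy n) hr (hd k) fun u hu =>
        (measurable_localLLR hy (hf 0) (hf 1) k u).mono ((observationFiltration y hy).mono hu) le_rfl
  abs_sub_le n := by
    filter_upwards [ae_all_iff.2 fun k => ae_all_iff.2 (hstep k),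
      ae_all_iff.2 fun k => ae_all_iff.2 (h_over k)] with ω h1 h2
    rw [fusionLLR, centralLLR, ← Finset.sum_sub_distrib]
    refine (Finset.abs_sum_le_sum_abs _ _).trans (Finset.sum_le_sum fun k _ => ?_)
    refine abs_fusionLocalLLR_sub_le (L := fun s => localLLR (f 0 k) (f 1 k) (y k) s ω) hΔ hθ hr
      (hd k) (by simp [localLLR]) (fun t => ?_) (h2 k) n
    rw [localLLR_succ_sub]
    exact h1 k t

theorem isApproximation_centralLLR (hf : ∀ i k, Measurable (f i k))
    (hy : ∀ k s, Measurable (y k s)) {D : ℝ} (hD : 0 ≤ D) :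
    IsApproximation P (observationFiltration y hy) (centralLLR f y) (centralLLR f y) D where
  zero ω := by simp [centralLLR, localLLR]
  adapted n := Finset.measurable_sum _ fun k _ => measurable_localLLR hy (hf 0) (hf 1) k n
  abs_sub_le n := Filter.Eventually.of_forall fun ω => by simpa using hD

end Detector

end LevelTriggered

/-! ### The main theorem -/

theorem theorem1 {Ω : Type*} [MeasurableSpace Ω] {K : ℕ}
    {𝓨 : Fin K → Type*} [∀ k, MeasurableSpace (𝓨 k)]
    -- reference measures and densities of one observation of sensor `k` under `H i`
    (ν : (k : Fin K) → Measure (𝓨 k)) (f : Fin 2 → (k : Fin K) → 𝓨 k → ℝ)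
    (hf_meas : ∀ i k, Measurable (f i k)) (hf_nonneg : ∀ i k x, 0 ≤ f i k x)
    -- the LLR of one observation is finite, and at least one sensor is informative
    (hf_supp : ∀ k, ∀ᵐ x ∂(ν k), f 0 k x = 0 ↔ f 1 k x = 0)
    (hf_ne : ∃ k, ¬ f 0 k =ᵐ[ν k] f 1 k)
    -- the observations: independent over time and sensors, `y k s` with density `f i k` under `P i`
    (P : Fin 2 → Measure Ω) [∀ i, IsProbabilityMeasure (P i)]
    (y : (k : Fin K) → ℕ → Ω → 𝓨 k) (hy_meas : ∀ k s, Measurable (y k s))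
    (hy_indep : ∀ i, iIndepFun (fun p : Fin K × ℕ => y p.1 p.2) (P i))
    (hy_law : ∀ i k s,
      (P i).map (y k s) = (ν k).withDensity (fun x => ENNReal.ofReal (f i k x)))
    -- sampling threshold, overshoot bound, encoding slope, channel delays
    (Δ θ r : ℝ) (d : Fin K → ℝ) (hΔ : 0 < Δ) (hθ : 0 ≤ θ) (hr : θ < r) (hd : ∀ k, 0 ≤ d k)
    (h_over : ∀ i k n, ∀ᵐ ω ∂(P i),
      LevelTriggered.samplingTime Δ
          (fun t => LevelTriggered.localLLR (f 0 k) (f 1 k) (y k) t ω) (n + 1) ≠ ⊤ →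
        LevelTriggered.overshoot Δ
          (fun t => LevelTriggered.localLLR (f 0 k) (f 1 k) (y k) t ω) n ≤ θ) :
    -- both detectors have finite average delay for all thresholds
    (∀ A B : ℝ, 0 < A → 0 < B → ∀ i,
      LevelTriggered.meanDelay P (LevelTriggered.centralLLR f y) A B i ≠ ⊤ ∧
      LevelTriggered.meanDelay P (LevelTriggered.fusionLLR f y Δ r d) A B i ≠ ⊤) ∧
    -- with equal error probabilities `α`, `β`, the average delays differ by `O(1)`
    (∃ C ε : ℝ, 0 < ε ∧ ∀ α β A B A' B' : ℝ,
      0 < α → α < ε → 0 < β → β < ε → 0 < A → 0 < B → 0 < A' → 0 < B' →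
      LevelTriggered.falseAlarm P (LevelTriggered.centralLLR f y) A B = α →
      LevelTriggered.missedDetection P (LevelTriggered.centralLLR f y) A B = β →
      LevelTriggered.falseAlarm P (LevelTriggered.fusionLLR f y Δ r d) A' B' = α →
      LevelTriggered.missedDetection P (LevelTriggered.fusionLLR f y Δ r d) A' B' = β →
      ∀ i,
        |(LevelTriggered.meanDelay P (LevelTriggered.fusionLLR f y Δ r d) A' B' i).toReal -
          (LevelTriggered.meanDelay P (LevelTriggered.centralLLR f y) A B i).toReal| ≤ C) ∧
    -- constraints that may not be attainable with equality
    (∀ M : ℝ, ∃ C ε : ℝ, 0 < ε ∧ ∀ α β : ℝ,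
      0 < α → α < ε → 0 < β → β < ε → β * |Real.log α| ≤ M → α * |Real.log β| ≤ M →
      ∃ A' B' : ℝ, 0 < A' ∧ 0 < B' ∧
        LevelTriggered.falseAlarm P (LevelTriggered.fusionLLR f y Δ r d) A' B' ≤ α ∧
        LevelTriggered.missedDetection P (LevelTriggered.fusionLLR f y Δ r d) A' B' ≤ β ∧
        ∀ A B : ℝ, 0 < A → 0 < B →
          LevelTriggered.falseAlarm P (LevelTriggered.centralLLR f y) A B ≤ α →
          LevelTriggered.missedDetection P (LevelTriggered.centralLLR f y) A B ≤ β →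
          ∀ i,
            (LevelTriggered.meanDelay P (LevelTriggered.fusionLLR f y Δ r d) A' B' i).toReal ≤
              (LevelTriggered.meanDelay P (LevelTriggered.centralLLR f y) A B i).toReal + C) := by
  have hr0 : 0 < r := hθ.trans_lt hr
  have hstep i k s : ∀ᵐ ω ∂(P i), |Real.log (f 1 k (y k s ω) / f 0 k (y k s ω))| ≤ Δ + θ :=
    LevelTriggered.ae_abs_log_div_le_of_overshoot_le hf_meas hy_meas hθ k (hy_law i k)
      (h_over i k 0) s
  set D : ℝ := ∑ k, (Δ + (⌈d k⌉₊ + 1 : ℕ) * (Δ + θ))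
  have hD : 0 ≤ D := Finset.sum_nonneg fun k _ => by positivity
  set c : ℝ := K * (Δ + θ)
  obtain ⟨μ₁, hL₁⟩ : ∃ μ₁, LevelTriggered.IsLLRProcess (P 1) (P 0)
      (LevelTriggered.observationFiltration y hy_meas) (LevelTriggered.centralLLR f y) c μ₁ :=
    ⟨_, LevelTriggered.isLLRProcess_sum_localLLR hy_meas (hf_meas 0) (hf_meas 1) (hf_nonneg 0)
      (hf_nonneg 1) hf_supp hf_ne (hy_indep 1) (hy_indep 0) (hy_law 1) (hy_law 0) (hstep 1)⟩
  have hlog k x : Real.log (f 0 k x / f 1 k x) = -Real.log (f 1 k x / f 0 k x) := by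
    rw [← Real.log_inv, inv_div]
  obtain ⟨μ₀, hL₀⟩ : ∃ μ₀, LevelTriggered.IsLLRProcess (P 0) (P 1)
      (LevelTriggered.observationFiltration y hy_meas)
      (fun n ω => -LevelTriggered.centralLLR f y n ω) c μ₀ := by
    have h := LevelTriggered.isLLRProcess_sum_localLLR hy_meas (hf_meas 1) (hf_meas 0)
      (hf_nonneg 1) (hf_nonneg 0) (fun k => (hf_supp k).mono fun x hx => hx.symm)
      (hf_ne.imp fun k hk h => hk h.symm) (hy_indep 0) (hy_indep 1) (hy_law 0) (hy_law 1)
      (φ := Δ + θ) fun k s => (hstep 0 k s).mono fun ω hω => by rwa [hlog, abs_neg]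
    simp only [LevelTriggered.localLLR, hlog, Finset.sum_neg_distrib] at h
    exact ⟨_, h⟩
  -- The SPRT statistic has no approximation error, but using `D` here too gives both tests the same
  -- constant `R`.
  have hC i := LevelTriggered.isApproximation_centralLLR (P := P i) hf_meas hy_meas hD
  have hX i := LevelTriggered.isApproximation_fusionLLR (P := P i) hf_meas hy_meas hΔ hr hr0 hd
    (hstep i) (h_over i)
  set R : ℝ := c + 3 * D
  have hR : 0 ≤ R := by positivity
  have hμ₁ := hL₁.drift_pos
  have hμ₀ := hL₀.drift_pos
  refine ⟨fun A B hA hB i =>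
    ⟨LevelTriggered.meanDelay_ne_top_of_isLLRProcess hL₁ hL₀ hC hA hB i,
      LevelTriggered.meanDelay_ne_top_of_isLLRProcess hL₁ hL₀ hX hA hB i⟩, ?_, fun M => ?_⟩
  -- No smallness is needed here: error probabilities below 1 suffice to cancel `1 - α` and `1 - β`.
  · refine ⟨max (4 * R / μ₀) (4 * R / μ₁), 1, one_pos, ?_⟩
    intro α β A B A' B' _ hα1 _ hβ1 hA hB hA' hB' e1 e2 e3 e4 i
    obtain ⟨w1, w0⟩ := LevelTriggered.waldBounds_of_isLLRProcess hL₁ hL₀ hC hA hB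
    obtain ⟨w1', w0'⟩ := LevelTriggered.waldBounds_of_isLLRProcess hL₁ hL₀ hX hA' hB'
    rw [e1, e2] at w1 w0
    rw [e3, e4] at w1' w0'
    match i with
    | 0 =>
      exact (w0.abs_delay_sub_le w0' hμ₀ hα1 (w1.abs_threshold_sub_le w1' hβ1)).trans
        (le_max_left _ _)
    | 1 =>
      exact (w1.abs_delay_sub_le w1' hμ₁ hβ1 (w0.abs_threshold_sub_le w0' hα1)).trans
        (le_max_right _ _)
  -- `G` is the gap between the upper bound `-log α + 2 * R` from `drift_mul_le` and the lower bound
  -- from `le_drift_mul`; `log α` cancels, and likewise `log β` under `H₀`.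
  · set G : ℝ := M + Real.log 2 + Real.exp R + 4 * R
    refine ⟨max (G / μ₀) (G / μ₁), 1 / 2, by norm_num, ?_⟩
    intro α β hα hα1 hβ hβ1 hM hM'
    have hlogα : Real.log α < 0 := Real.log_neg hα (by linarith)
    have hlogβ : Real.log β < 0 := Real.log_neg hβ (by linarith)
    have hA' : 0 < -Real.log α + R := by linarith
    have hB' : 0 < -Real.log β + R := by linarith
    obtain ⟨w1', w0'⟩ := LevelTriggered.waldBounds_of_isLLRProcess hL₁ hL₀ hX hA' hB'
    refine ⟨-Real.log α + R, -Real.log β + R, hA', hB', ?_, ?_, ?_⟩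
    · refine w1'.left_le.trans ?_
      rw [show -(-Real.log α + R) + R = Real.log α by ring, Real.exp_log hα]
      exact mul_le_of_le_one_right hα.le (by linarith [w1'.right_nonneg])
    · refine w0'.left_le.trans ?_
      rw [show -(-Real.log β + R) + R = Real.log β by ring, Real.exp_log hβ]
      exact mul_le_of_le_one_right hβ.le (by linarith [w0'.right_nonneg])
    · intro A B hA hB ha hb i
      obtain ⟨w1, w0⟩ := LevelTriggered.waldBounds_of_isLLRProcess hL₁ hL₀ hC hA hB
      have habs := abs_of_nonneg hR
      match i with
      | 0 =>
        have h1 := w0'.drift_mul_le hB' hA'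
        have h2 := w0.le_drift_mul w1.left_le hB hβ hβ1 hα1 hb ha hM'
        refine le_trans ?_ (add_le_add_right (le_max_left _ _) _)
        rw [← sub_le_iff_le_add', le_div_iff₀' hμ₀]
        linarith
      | 1 =>
        have h1 := w1'.drift_mul_le hA' hB'
        have h2 := w1.le_drift_mul w0.left_le hA hα hα1 hβ1 ha hb hM
        refine le_trans ?_ (add_le_add_right (le_max_right _ _) _)
        rw [← sub_le_iff_le_add', le_div_iff₀' hμ₁]
        linarith
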